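/- For every real $C'$ there is a number $\alpha=\alpha(C')>0$, depending only on $C'$, such that the following holds. Let $(T,m)$ and $(\Omega,\mathbb P)$ be probability spaces, let $N\ge 0$, and let $d_1,\dots,d_N$ be nonnegative integers. Let $g_n$ $(1\le n\le N)$ be random $d_n\times d_n$ matrices on $(\Omega,\mathbb P)$ such that the variables $d_n^{1/2}g_n(i,j)$ $(1\le n\le N,\ 1\le i,j\le d_n)$ are i.i.d. normalized complex Gaussian variables, i.e. each is distributed as $2^{-1/2}(g'+ig'')$ with $g',g''$ independent real $N(0,1)$ variables. Let $\psi_n\in L_\infty(T,m;M_{d_n})$ $(1\le n\le N)$ satisfy $$\sup_n\|\psi_n\|_{L_\infty(m;M_{d_n})}\le C',$$ where $M_d$ is the space of complex $d\times d$ matrices with the operator norm of $\ell_2^d$. Assume that the system $\{d_n^{1/2}\psi_n(i,j)\}$ admits a biorthogonal system that is $1$-dominated by $\{d_n^{1/2}g_n(i,j)\}$; that is, there are functions $\varphi_{n,i,j}\in L_1(T,m)$ $(1\le n\le N,\ 1\le i,j\le d_n)$ with $$\int_T \varphi_{n,i,j}\,\overline{d_{n'}^{1/2}\psi_{n'}(k,\ell)}\;dm=\delta_{n,n'}\,\delta_{i,k}\,\delta_{j,\ell}$$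 for all indices, and there is a bounded linear operator $u:L_1(\Omega,\mathbb P)\to L_1(T,m)$ with $\|u\|\le 1$ and $u\big(d_n^{1/2}g_n(i,j)\big)=\varphi_{n,i,j}$ for all $n,i,j$. Then $(\psi_n)$ is $\dot\otimes^2$-Sidon with constant $\alpha$: for every finite set $s$ of indices in $\{1,\dots,N\}$ and all matrices $x_k\in M_{d_k}$, $$\sum_{k\in s} d_k\,\mathrm{tr}|x_k|\;\le\;\alpha\,\Big\|\sum_{k\in s} d_k\,\mathrm{tr}\big(x_k\,\psi_k(t_1)\psi_k(t_2)\big)\Big\|_{L_\infty(T\times T,\;m\times m)},\qquad |x|=(x^*x)^{1/2}.$$ -/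

import Mathlib

open MeasureTheory ProbabilityTheory
open scoped ENNReal ComplexConjugate Matrix Matrix.Norms.L2Operator MatrixOrder

universe u v

namespace MatricialSidon

noncomputable section

/-- Complex `k × k` matrices; they carry the operator norm of `ℓ₂ᵏ`
(the norm brought in by the scope `Matrix.Norms.L2Operator`). -/
abbrev Mat (k : ℕ) : Type := Matrix (Fin k) (Fin k) ℂ

/-- `tr |x|`, where `|x| = (x* x)^{1/2}`. -/
def traceAbs {k : ℕ} (x : Mat k) : ℝ := (CFC.abs x).trace.re

/-- The law of the normalized complex Gaussian variable `2^{-1/2} (g' + i g'')`, where `g'`, `g''`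
are independent real `N(0,1)` variables. -/
def stdComplexGaussian : Measure ℂ :=
  ((gaussianReal 0 1).prod (gaussianReal 0 1)).map
    fun p : ℝ × ℝ => (((√2)⁻¹ : ℝ) : ℂ) * ((p.1 : ℂ) + (p.2 : ℂ) * Complex.I)

/-- The family `(φ_p)` in `L₁(m)` is `C`-dominated by the family `(γ_p)` in `L₁(P)`: there is a
bounded linear operator `u : L₁(P) → L₁(m)` with `‖u‖ ≤ C` and `u γ_p = φ_p` for all `p`. -/
def IsDominatedBy {Ω : Type u} {T : Type v} [MeasurableSpace Ω] [MeasurableSpace T]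
    {P : Measure Ω} {m : Measure T} {I : Type} (C : ℝ) (φ : I → Lp ℂ 1 m) (γ : I → Lp ℂ 1 P) :
    Prop :=
  ∃ S : Lp ℂ 1 P →L[ℂ] Lp ℂ 1 m, ‖S‖ ≤ C ∧ ∀ p, S (γ p) = φ p

/-- `∫ φ_p conj(η_q) dm = δ_{pq}`. -/
def IsBiorthogonal {T : Type u} [MeasurableSpace T] (m : Measure T) {I : Type} [DecidableEq I]
    (φ η : I → T → ℂ) : Prop :=
  ∀ p q, ∫ t, φ p t * conj (η q t) ∂m = if p = q then 1 else 0

/-- The indices `(n, i, j)` of the entries of a sequence of matrices of sizes `d_1, …, d_N`. -/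
abbrev EntryIndex {N : ℕ} (d : Fin N → ℕ) : Type := Σ n : Fin N, Fin (d n) × Fin (d n)

/-- The normalized entries `d_n^{1/2} ψ_n(i,j)` of a matrix valued system. -/
def normalizedEntry {T : Type u} {N : ℕ} {d : Fin N → ℕ} (ψ : (n : Fin N) → T → Mat (d n))
    (p : EntryIndex d) (t : T) : ℂ :=
  ((√(d p.1 : ℝ) : ℝ) : ℂ) * ψ p.1 t p.2.1 p.2.2

/-- The normalized entries `d_n^{1/2} g_n(i,j)` of matrices with entries in `L₁(P)`. -/
def normalizedEntryL1 {Ω : Type u} [MeasurableSpace Ω] {P : Measure Ω} {N : ℕ} {d : Fin N → ℕ}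
    (g : (n : Fin N) → Matrix (Fin (d n)) (Fin (d n)) (Lp ℂ 1 P)) (p : EntryIndex d) : Lp ℂ 1 P :=
  ((√(d p.1 : ℝ) : ℝ) : ℂ) • g p.1 p.2.1 p.2.2

/-- `(g_n)` is an independent sequence of random `d_n × d_n` matrices such that all the variables
`d_n^{1/2} g_n(i,j)` are i.i.d. normalized complex Gaussian variables. -/
structure IsGaussianMatrixSystem {Ω : Type u} [MeasurableSpace Ω] {P : Measure Ω} {N : ℕ}
    {d : Fin N → ℕ} (g : (n : Fin N) → Matrix (Fin (d n)) (Fin (d n)) (Lp ℂ 1 P)) : Prop where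
  law : ∀ p : EntryIndex d, HasLaw (normalizedEntryL1 g p : Ω → ℂ) stdComplexGaussian P
  indep : iIndepFun (fun (p : EntryIndex d) (ω : Ω) => normalizedEntryL1 g p ω) P

/-- The system `(φ_k)` of matrix valued functions on `(T, m)` is Sidon with constant `C`: for every
finite set `s` of indices and all matrices `x_k`,
`∑_{k ∈ s} d_k tr|x_k| ≤ C ‖∑_{k ∈ s} d_k tr(x_k φ_k)‖_{L_∞(m)}`. -/
def IsSidon {T : Type u} [MeasurableSpace T] (m : Measure T) {ι : Type} {d : ι → ℕ}
    (φ : (k : ι) → T → Mat (d k)) (C : ℝ) : Prop :=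
  ∀ (s : Finset ι) (x : (k : ι) → Mat (d k)),
    ENNReal.ofReal (∑ k ∈ s, (d k : ℝ) * traceAbs (x k)) ≤
      ENNReal.ofReal C *
        eLpNorm (fun t => ∑ k ∈ s, (d k : ℂ) * (x k * φ k t).trace) ∞ m

/-- `(ψ¹ ⊗̇ ψ²)(t₁, t₂) = ψ¹(t₁) ψ²(t₂)` (matrix product). -/
def dotTensor {T₁ : Type u} {T₂ : Type v} {k : ℕ} (ψ₁ : T₁ → Mat k) (ψ₂ : T₂ → Mat k) :
    T₁ × T₂ → Mat k :=
  fun t => ψ₁ t.1 * ψ₂ t.2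

/-- `(ψ_k)` is `⊗̇²`-Sidon with constant `C`: the system `(ψ_k ⊗̇ ψ_k)` on `(T × T, m × m)` is Sidon
with constant `C`. -/
def IsDotTensorSqSidon {T : Type u} [MeasurableSpace T] (m : Measure T) {ι : Type} {d : ι → ℕ}
    (ψ : (k : ι) → T → Mat (d k)) (C : ℝ) : Prop :=
  IsSidon (m.prod m) (fun k => dotTensor (ψ k) (ψ k)) C

end

end MatricialSidon

/-! Domination moves the problem to Gaussian space. Composing the given operator with a change of
variables yields a contraction S from L₁(γ) to L₁(m), where γ is the standard Gaussian measure on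
families of matrices, sending the coordinate x_p to √2 φ_p. Its conjugate adjoint maps the
conjugated normalized entries of ψ to functions h_q with ∫ conj(x_p) h_q dγ = √2 δ_{pq}. It does not
increase sup norms and, by Fubini, neither does its tensor square
(`ae_norm_sum_conjAdjoint_mul_le`). Hence H = ∑ x_n(a,b) h_{n,b,c} ⊗ h_{n,c,a} is bounded by M, the
norm on the right-hand side.

Let w_n be the entrywise conjugate of a unitary polar factor of x_n. The form Q(f,g) = ½ ∑ w_n(a,b)
(∫ x̄_n(b,c) f)(∫ x̄_n(c,a) g) takes H to s = ∑ d_n tr|x_n|. It sees only the first chaos, and is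
compared with Mehler forms: up to a rotation, half the difference of the forms at ρ and −ρ, divided
by ρ, agrees with a first chaos form in degree 1, vanishes in even degrees, and carries a factor
ρ^{k-1} in odd degree k (`exists_remainder_of_wave`). A Mehler form integrates against a probability
measure absolutely continuous with respect to γ × γ, so this part contributes at most M/ρ on H.

The remainder has norm at most ρ² on L₂. A singular value decomposition of x_n and the bound C' on
ψ_n show that its value on H is at most ρ² C'² s (`norm_sum_trilinear_le`), hence at most s/2 for
small ρ. So s ≤ M/ρ + s/2 (`sum_traceAbs_le`), and α = 2/ρ works. -/

namespace MatricialSidon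

/-! ### Null sets and the Mehler rotation for the standard Gaussian measure. -/

section GaussianSpace

open scoped RealInnerProductSpace

variable {E : Type*} [NormedAddCommGroup E] [InnerProductSpace ℝ E] [FiniteDimensional ℝ E]
  [MeasurableSpace E] [BorelSpace E]

/-- The standard Gaussian measure has an everywhere positive density. -/
theorem stdGaussian_eq_withDensity :
    ∃ c : ℝ, 0 < c ∧ stdGaussian E =
      volume.withDensity fun x : E => ENNReal.ofReal (c * Real.exp (-(2⁻¹ * ‖x‖ ^ 2))) := by
  set n : ℝ := ((Module.finrank ℝ E : ℕ) : ℝ)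
  set K : ℝ := (Real.pi / 2⁻¹) ^ (n / 2) with hK
  have hKpos : 0 < K := by positivity
  have hint : ∀ t : E, ∫ x : E, Complex.exp (-(2⁻¹ : ℂ) * (‖x‖ : ℂ) ^ 2 + Complex.I * (⟪t, x⟫ : ℝ)) =
      (K : ℂ) * Complex.exp (-(‖t‖ : ℂ) ^ 2 / 2) := by
    intro t
    rw [GaussianFourier.integral_cexp_neg_mul_sq_norm_add (by norm_num) Complex.I t]
    congr 1
    · rw [hK, Complex.ofReal_cpow (by positivity)]
      push_cast
      rfl
    · congr 1
      rw [Complex.I_sq]; ring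
  have hInt : Integrable fun x : E => Real.exp (-(2⁻¹ * ‖x‖ ^ 2)) := by
    -- A non-integrable function has integral 0 by convention, while the Fourier formula at t = 0
    -- gives K ≠ 0; integrability is thus read off from the formula.
    by_contra h
    have h0 := hint 0
    rw [integral_undef] at h0
    · simp at h0
      exact hKpos.ne (by exact_mod_cast h0)
    · intro h1
      apply h
      refine h1.norm.congr (Filter.Eventually.of_forall fun x => ?_)
      simp only [inner_zero_left, Complex.norm_exp]
      congr 1
      simp [← Complex.ofReal_pow]
  refine ⟨K⁻¹, by positivity, ?_⟩
  have hInt' : Integrable fun x : E => K⁻¹ * Real.exp (-(2⁻¹ * ‖x‖ ^ 2)) := hInt.const_mul _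
  have hfin : IsFiniteMeasure
      (volume.withDensity fun x : E => ENNReal.ofReal (K⁻¹ * Real.exp (-(2⁻¹ * ‖x‖ ^ 2)))) :=
    isFiniteMeasure_withDensity_ofReal hInt'.2
  refine Measure.ext_of_charFun (funext fun t => ?_)
  rw [charFun_stdGaussian, charFun_apply, integral_withDensity_eq_integral_toReal_smul
    (by fun_prop) (by simp)]
  have : ∀ x : E, (ENNReal.ofReal (K⁻¹ * Real.exp (-(2⁻¹ * ‖x‖ ^ 2)))).toReal •
      Complex.exp ((⟪x, t⟫ : ℝ) * Complex.I) =
      (K : ℂ)⁻¹ * Complex.exp (-(2⁻¹ : ℂ) * (‖x‖ : ℂ) ^ 2 + Complex.I * (⟪t, x⟫ : ℝ)) := by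
    intro x
    rw [ENNReal.toReal_ofReal (by positivity), Complex.real_smul, real_inner_comm, Complex.exp_add]
    push_cast
    rw [mul_assoc, mul_comm Complex.I]
    congr 3
    ring
  simp_rw [this]
  rw [integral_const_mul, hint, inv_mul_cancel_left₀]
  simpa using hKpos.ne'

theorem stdGaussian_absolutelyContinuous : stdGaussian E ≪ (volume : Measure E) := by
  obtain ⟨c, -, h⟩ := stdGaussian_eq_withDensity (E := E)
  rw [h]
  exact withDensity_absolutelyContinuous _ _

theorem absolutelyContinuous_stdGaussian : (volume : Measure E) ≪ stdGaussian E := by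
  obtain ⟨c, hc, h⟩ := stdGaussian_eq_withDensity (E := E)
  rw [h]
  refine withDensity_absolutelyContinuous' (by fun_prop) (Filter.Eventually.of_forall fun x => ?_)
  have : 0 < c * Real.exp (-(2⁻¹ * ‖x‖ ^ 2)) := by positivity
  simpa using this

/-- Non-degenerate affine maps preserve Gaussian null sets. -/
theorem quasiMeasurePreserving_add_smul {s : ℝ} (hs : s ≠ 0) (v : E) :
    Measure.QuasiMeasurePreserving (fun y : E => v + s • y) (stdGaussian E) (stdGaussian E) := by
  have h1 : Measure.QuasiMeasurePreserving (fun y : E => v + s • y) volume volume :=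
    (measurePreserving_add_left volume v).quasiMeasurePreserving.comp
      (Measure.quasiMeasurePreserving_smul volume hs)
  exact (h1.mono_left stdGaussian_absolutelyContinuous).mono_right absolutelyContinuous_stdGaussian

/-- The pair (x, rx + sy) need not have the product law, but slice by slice a nonzero s keeps null
sets null. This lets a bound valid almost everywhere for the product measure be used along Mehler's
pair. -/
theorem quasiMeasurePreserving_prodMk_add_smul (r : ℝ) {s : ℝ} (hs : s ≠ 0) :
    Measure.QuasiMeasurePreserving (fun z : E × E => (z.1, r • z.1 + s • z.2))
      ((stdGaussian E).prod (stdGaussian E)) ((stdGaussian E).prod (stdGaussian E)) := by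
  refine ⟨by fun_prop, Measure.AbsolutelyContinuous.mk fun A hA h => ?_⟩
  rw [Measure.map_apply (by fun_prop) hA, Measure.measure_prod_null
    ((by fun_prop : Measurable fun z : E × E => (z.1, r • z.1 + s • z.2)) hA)]
  rw [Measure.measure_prod_null hA] at h
  filter_upwards [h] with x hx
  exact (quasiMeasurePreserving_add_smul hs (r • x)).preimage_null hx

/-- `ρ x + (1 - ρ²)^{1/2} y`. -/
noncomputable def mehlerMap (ρ : ℝ) (z : E × E) : E := ρ • z.1 + √(1 - ρ ^ 2) • z.2

theorem measurable_mehlerMap (ρ : ℝ) : Measurable (mehlerMap (E := E) ρ) := by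
  unfold mehlerMap; fun_prop

theorem integral_cexp_inner_stdGaussian (t : E) :
    ∫ x, Complex.exp ((⟪x, t⟫ : ℝ) * Complex.I) ∂stdGaussian E =
      Complex.exp (-(‖t‖ : ℂ) ^ 2 / 2) := by
  rw [← charFun_apply, charFun_stdGaussian]

theorem integral_cexp_mehlerMap {ρ : ℝ} (hρ : ρ ^ 2 ≤ 1) (s t : E) :
    ∫ z, Complex.exp ((⟪z.1, s⟫ : ℝ) * Complex.I) *
      Complex.exp ((⟪mehlerMap ρ z, t⟫ : ℝ) * Complex.I) ∂(stdGaussian E).prod (stdGaussian E) =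
      Complex.exp (-((‖s‖ ^ 2 + ‖t‖ ^ 2 + 2 * ρ * ⟪s, t⟫ : ℝ) : ℂ) / 2) := by
  have : ∀ z : E × E, Complex.exp ((⟪z.1, s⟫ : ℝ) * Complex.I) *
      Complex.exp ((⟪mehlerMap ρ z, t⟫ : ℝ) * Complex.I) =
      Complex.exp ((⟪z.1, s + ρ • t⟫ : ℝ) * Complex.I) *
      Complex.exp ((⟪z.2, √(1 - ρ ^ 2) • t⟫ : ℝ) * Complex.I) := by
    intro z
    rw [← Complex.exp_add, ← Complex.exp_add, mehlerMap, inner_add_left, inner_add_right,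
      real_inner_smul_left, real_inner_smul_left, real_inner_smul_right, real_inner_smul_right]
    congr 1
    push_cast
    ring
  simp_rw [this]
  rw [integral_prod_mul (fun x : E => Complex.exp ((⟪x, s + ρ • t⟫ : ℝ) * Complex.I))
    (fun x : E => Complex.exp ((⟪x, √(1 - ρ ^ 2) • t⟫ : ℝ) * Complex.I)),
    integral_cexp_inner_stdGaussian, integral_cexp_inner_stdGaussian, ← Complex.exp_add]
  congr 1
  rw [← Complex.ofReal_pow, ← Complex.ofReal_pow, norm_add_sq_real, norm_smul, norm_smul,
    real_inner_smul_right, mul_pow, mul_pow, Real.norm_eq_abs, Real.norm_eq_abs, sq_abs, sq_abs,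
    Real.sq_sqrt (by linarith)]
  push_cast
  ring

theorem measurePreserving_mehlerMap {ρ : ℝ} (hρ : ρ ^ 2 ≤ 1) :
    MeasurePreserving (mehlerMap (E := E) ρ)
      ((stdGaussian E).prod (stdGaussian E)) (stdGaussian E) := by
  refine ⟨measurable_mehlerMap ρ, ?_⟩
  have : IsFiniteMeasure
      (((stdGaussian E).prod (stdGaussian E)).map (mehlerMap (E := E) ρ)) :=
    Measure.isFiniteMeasure_map _ _
  refine Measure.ext_of_charFun (funext fun t => ?_)
  rw [charFun_stdGaussian, charFun_apply,
    integral_map (measurable_mehlerMap ρ).aemeasurable (by fun_prop)]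
  have := integral_cexp_mehlerMap hρ 0 t
  simpa using this

end GaussianSpace

/-! ### Imaginary exponentials: Gram kernel, first moments, totality in L₂. -/

section GaussianExponentials

open scoped RealInnerProductSpace

variable {E : Type*} [NormedAddCommGroup E] [InnerProductSpace ℝ E] [FiniteDimensional ℝ E]
  [MeasurableSpace E] [BorelSpace E]

/-- The normalized imaginary exponential `exp(i⟨x,t⟩ + |t|²/2)`. -/
noncomputable def waveFun (t x : E) : ℂ :=
  Complex.exp ((‖t‖ : ℂ) ^ 2 / 2) * Complex.exp ((⟪x, t⟫ : ℝ) * Complex.I)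

omit [FiniteDimensional ℝ E] [MeasurableSpace E] [BorelSpace E] in
theorem continuous_waveFun (t : E) : Continuous (waveFun t) := by
  unfold waveFun; fun_prop

omit [FiniteDimensional ℝ E] [MeasurableSpace E] [BorelSpace E] in
theorem norm_waveFun (t x : E) : ‖waveFun t x‖ = Real.exp (‖t‖ ^ 2 / 2) := by
  rw [waveFun, norm_mul, Complex.norm_exp_ofReal_mul_I, mul_one, Complex.norm_exp]
  norm_cast

theorem memLp_waveFun (t : E) : MemLp (waveFun t) 2 (stdGaussian E) :=
  MemLp.of_bound (continuous_waveFun t).aestronglyMeasurable _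
    (Filter.Eventually.of_forall fun x => (norm_waveFun t x).le)

/-- The class in `L₂` of `waveFun t`. -/
noncomputable def wave (t : E) : Lp ℂ 2 (stdGaussian E) := (memLp_waveFun t).toLp _

theorem coeFn_wave (t : E) : wave t =ᵐ[stdGaussian E] waveFun t := MemLp.coeFn_toLp _

omit [FiniteDimensional ℝ E] [MeasurableSpace E] [BorelSpace E] in
theorem conj_waveFun (t x : E) : conj (waveFun t x) = waveFun (-t) x := by
  rw [waveFun, waveFun, map_mul, ← Complex.exp_conj, ← Complex.exp_conj]
  simp [map_ofNat]

/-- The normalization in `waveFun` makes the Gram kernel exactly exp⟨s,t⟩; the degree k term of its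
power series is the contribution of the k-th chaos, so chaoses can be handled without Hermite
polynomials. -/
theorem inner_wave (s t : E) : inner ℂ (wave s) (wave t) = Complex.exp (⟪s, t⟫ : ℝ) := by
  rw [L2.inner_def]
  have : ∀ᵐ x ∂stdGaussian E, inner ℂ (wave s x) (wave t x) =
      Complex.exp (((‖s‖ : ℂ) ^ 2 + (‖t‖ : ℂ) ^ 2) / 2) *
        Complex.exp ((⟪x, t - s⟫ : ℝ) * Complex.I) := by
    filter_upwards [coeFn_wave s, coeFn_wave t] with x h1 h2
    rw [h1, h2, RCLike.inner_apply, conj_waveFun, waveFun, waveFun, inner_sub_right,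
      inner_neg_right, norm_neg]
    simp only [← Complex.exp_add]
    congr 1
    push_cast
    ring
  rw [integral_congr_ae this, integral_const_mul, integral_cexp_inner_stdGaussian,
    ← Complex.exp_add, ← Complex.ofReal_pow ‖t - s‖, norm_sub_sq_real, real_inner_comm]
  congr 1
  push_cast
  ring

theorem integrable_inner_stdGaussian (ξ : E) :
    Integrable (fun x : E => ⟪x, ξ⟫) (stdGaussian E) :=
  (IsGaussian.integrable_id (μ := stdGaussian E)).inner_const ξ

/-- Differentiate the characteristic function at t in the direction ξ. -/
theorem integral_inner_mul_cexp_inner (ξ t : E) :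
    ∫ x, ((⟪x, ξ⟫ : ℝ) : ℂ) * Complex.exp ((⟪x, t⟫ : ℝ) * Complex.I) ∂stdGaussian E =
      Complex.I * (⟪ξ, t⟫ : ℝ) * Complex.exp (-(‖t‖ : ℂ) ^ 2 / 2) := by
  have key := (hasDerivAt_integral_of_dominated_loc_of_deriv_le (μ := stdGaussian E) (𝕜 := ℝ)
    (F := fun r x => Complex.exp ((⟪x, t + r • ξ⟫ : ℝ) * Complex.I))
    (F' := fun r x => (((⟪x, ξ⟫ : ℝ) : ℂ) * Complex.I) *
      Complex.exp ((⟪x, t + r • ξ⟫ : ℝ) * Complex.I))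
    (bound := fun x => ‖⟪x, ξ⟫‖) (x₀ := 0) (s := Set.univ) Filter.univ_mem
    (Filter.Eventually.of_forall fun r => by fun_prop)
    (Integrable.of_bound (C := 1) (by fun_prop)
      (Filter.Eventually.of_forall fun x => by rw [Complex.norm_exp_ofReal_mul_I]))
    (by fun_prop)
    (Filter.Eventually.of_forall fun x r _ => by
      rw [norm_mul, Complex.norm_exp_ofReal_mul_I]; simp)
    (integrable_inner_stdGaussian ξ).norm
    (Filter.Eventually.of_forall fun x r _ => by
      have h1 : HasDerivAt (fun r : ℝ => ((⟪x, t⟫ + r * ⟪x, ξ⟫ : ℝ) : ℂ) * Complex.I)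
          (((⟪x, ξ⟫ : ℝ) : ℂ) * Complex.I) r := by
        have h0 : HasDerivAt (fun r : ℝ => (⟪x, t⟫ + r * ⟪x, ξ⟫ : ℝ)) (⟪x, ξ⟫) r := by
          simpa using ((hasDerivAt_id r).mul_const ⟪x, ξ⟫).const_add ⟪x, t⟫
        exact h0.ofReal_comp.mul_const _
      simpa [inner_add_right, real_inner_smul_right, mul_comm] using h1.cexp)).2
  have h2 : HasDerivAt (fun r : ℝ => Complex.exp (-((‖t‖ ^ 2 + 2 * r * ⟪t, ξ⟫ + r ^ 2 * ‖ξ‖ ^ 2 : ℝ)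
      : ℂ) / 2)) (-(⟪t, ξ⟫ : ℝ) * Complex.exp (-(‖t‖ : ℂ) ^ 2 / 2)) 0 := by
    have h0 : HasDerivAt (fun r : ℝ => (‖t‖ ^ 2 + 2 * r * ⟪t, ξ⟫ + r ^ 2 * ‖ξ‖ ^ 2 : ℝ))
        (2 * ⟪t, ξ⟫) 0 := by
      have := ((((hasDerivAt_id (0 : ℝ)).const_mul 2).mul_const ⟪t, ξ⟫).const_add (‖t‖ ^ 2)).add
        (((hasDerivAt_id (0 : ℝ)).pow 2).mul_const (‖ξ‖ ^ 2))
      exact this.congr_deriv (by simp)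
    have := (h0.ofReal_comp.neg.div_const 2).cexp
    convert this using 1
    simp only [Pi.neg_apply]
    push_cast
    simp
    ring
  have h3 : (fun r : ℝ => ∫ x, Complex.exp ((⟪x, t + r • ξ⟫ : ℝ) * Complex.I) ∂stdGaussian E) =
      fun r : ℝ => Complex.exp (-((‖t‖ ^ 2 + 2 * r * ⟪t, ξ⟫ + r ^ 2 * ‖ξ‖ ^ 2 : ℝ) : ℂ) / 2) := by
    funext r
    rw [integral_cexp_inner_stdGaussian, ← Complex.ofReal_pow, norm_add_sq_real, norm_smul,
      real_inner_smul_right, mul_pow, Real.norm_eq_abs, sq_abs]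
    congr 4
    ring
  rw [h3] at key
  have h4 := key.unique h2
  simp only [zero_smul, add_zero] at h4
  have h5 : ∫ x, ((⟪x, ξ⟫ : ℝ) : ℂ) * Complex.I * Complex.exp ((⟪x, t⟫ : ℝ) * Complex.I)
      ∂stdGaussian E = Complex.I *
      ∫ x, ((⟪x, ξ⟫ : ℝ) : ℂ) * Complex.exp ((⟪x, t⟫ : ℝ) * Complex.I) ∂stdGaussian E := by
    rw [← integral_const_mul]
    refine integral_congr_ae (Filter.Eventually.of_forall fun x => ?_)
    simp only
    ring
  rw [h5] at h4
  have h6 := congrArg (fun z => -Complex.I * z) h4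
  rw [← mul_assoc, neg_mul, Complex.I_mul_I, neg_neg, one_mul] at h6
  rw [h6, real_inner_comm]
  ring

theorem integral_inner_mul_wave (ξ t : E) :
    ∫ x, ((⟪x, ξ⟫ : ℝ) : ℂ) * wave t x ∂stdGaussian E = Complex.I * (⟪ξ, t⟫ : ℝ) := by
  have : ∀ᵐ x ∂stdGaussian E, ((⟪x, ξ⟫ : ℝ) : ℂ) * wave t x = Complex.exp ((‖t‖ : ℂ) ^ 2 / 2) *
      (((⟪x, ξ⟫ : ℝ) : ℂ) * Complex.exp ((⟪x, t⟫ : ℝ) * Complex.I)) := by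
    filter_upwards [coeFn_wave t] with x h
    rw [h, waveFun]
    ring
  rw [integral_congr_ae this, integral_const_mul, integral_inner_mul_cexp_inner, mul_left_comm,
    ← Complex.exp_add]
  ring_nf
  simp

/-- The finite measures with densities f⁺ and f⁻ have the same characteristic function, hence
coincide. -/
theorem ae_eq_zero_of_integral_cexp_eq_zero {μ : Measure E} [IsFiniteMeasure μ] {f : E → ℝ}
    (hf : Integrable f μ)
    (h : ∀ t : E, ∫ x, (f x : ℂ) * Complex.exp ((⟪x, t⟫ : ℝ) * Complex.I) ∂μ = 0) :
    f =ᵐ[μ] 0 := by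
  have hfm : AEMeasurable f μ := hf.aemeasurable
  have hp : ∀ g : E → ℝ, Integrable g μ →
      IsFiniteMeasure (μ.withDensity fun x => ENNReal.ofReal (g x)) := fun g hg =>
    isFiniteMeasure_withDensity_ofReal hg.2
  have h1 := hp f hf
  have h2 := hp (fun x => -f x) hf.neg
  have hi : ∀ (g : E → ℝ) (t : E), Integrable g μ →
      Integrable (fun x => (g x : ℂ) * Complex.exp ((⟪x, t⟫ : ℝ) * Complex.I)) μ := by
    intro g t hg
    refine hg.ofReal.mul_bdd (c := 1) (by fun_prop) (Filter.Eventually.of_forall fun x => ?_)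
    rw [Complex.norm_exp_ofReal_mul_I]
  have heq : (μ.withDensity fun x => ENNReal.ofReal (f x)) =
      μ.withDensity fun x => ENNReal.ofReal (-f x) := by
    refine Measure.ext_of_charFun (funext fun t => ?_)
    rw [charFun_apply, charFun_apply, integral_withDensity_eq_integral_toReal_smul₀
      (by fun_prop) (by simp), integral_withDensity_eq_integral_toReal_smul₀
      (by fun_prop) (by simp), ← sub_eq_zero, ← integral_sub]
    · rw [← h t]
      refine integral_congr_ae (Filter.Eventually.of_forall fun x => ?_)
      simp only [ENNReal.toReal_ofReal', Complex.real_smul]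
      rw [← sub_mul, ← Complex.ofReal_sub]
      congr 2
      rcases le_total (f x) 0 with h0 | h0
      · rw [max_eq_right h0, max_eq_left (by linarith)]; ring
      · rw [max_eq_left h0, max_eq_right (by linarith)]; ring
    · simpa only [ENNReal.toReal_ofReal', Complex.real_smul] using hi _ t hf.pos_part
    · simpa only [ENNReal.toReal_ofReal', Complex.real_smul] using hi _ t hf.neg_part
  rw [withDensity_eq_iff (by fun_prop) (by fun_prop) hf.lintegral_lt_top.ne] at heq
  filter_upwards [heq] with x hx
  have := congrArg ENNReal.toReal hx
  rw [ENNReal.toReal_ofReal', ENNReal.toReal_ofReal'] at this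
  rcases le_total (f x) 0 with h0 | h0
  · rw [max_eq_right h0, max_eq_left (by linarith)] at this
    simpa using this.symm
  · rw [max_eq_left h0, max_eq_right (by linarith)] at this
    simpa using this

/-- If f is orthogonal to all waves, the Fourier transform of f times the Gaussian measure vanishes.
Conjugating and changing t to −t gives the same for conj f, hence for the real and imaginary parts
of f. -/
theorem dense_span_wave :
    (Submodule.span ℂ (Set.range (wave (E := E)))).topologicalClosure = ⊤ := by
  rw [Submodule.topologicalClosure_eq_top_iff, Submodule.eq_bot_iff]
  intro f hf
  have hmem : Integrable f (stdGaussian E) := (Lp.memLp f).integrable (by norm_num)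
  have h0 : ∀ t : E, ∫ x, f x * Complex.exp ((⟪x, t⟫ : ℝ) * Complex.I) ∂stdGaussian E = 0 := by
    intro t
    have h1 : inner ℂ (wave (-t)) f = 0 :=
      (Submodule.mem_orthogonal _ _).1 hf _ (Submodule.subset_span ⟨-t, rfl⟩)
    rw [L2.inner_def] at h1
    have h2 : ∀ᵐ x ∂stdGaussian E, inner ℂ (wave (-t) x) (f x) = Complex.exp ((‖t‖ : ℂ) ^ 2 / 2) *
        (f x * Complex.exp ((⟪x, t⟫ : ℝ) * Complex.I)) := by
      filter_upwards [coeFn_wave (-t)] with x hx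
      rw [hx, RCLike.inner_apply, conj_waveFun, neg_neg, waveFun]
      ring
    rw [integral_congr_ae h2, integral_const_mul] at h1
    exact (mul_eq_zero.1 h1).resolve_left (Complex.exp_ne_zero _)
  have hi : ∀ t : E,
      Integrable (fun x => f x * Complex.exp ((⟪x, t⟫ : ℝ) * Complex.I)) (stdGaussian E) := by
    intro t
    refine hmem.mul_bdd (c := 1) (by fun_prop) (Filter.Eventually.of_forall fun x => ?_)
    rw [Complex.norm_exp_ofReal_mul_I]
  have h0' : ∀ t : E,
      ∫ x, conj (f x) * Complex.exp ((⟪x, t⟫ : ℝ) * Complex.I) ∂stdGaussian E = 0 := by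
    intro t
    have := congrArg conj (h0 (-t))
    rw [← integral_conj, map_zero] at this
    rw [← this]
    refine integral_congr_ae (Filter.Eventually.of_forall fun x => ?_)
    simp [← Complex.exp_conj]
  have hi' : ∀ t : E,
      Integrable (fun x => conj (f x) * Complex.exp ((⟪x, t⟫ : ℝ) * Complex.I))
        (stdGaussian E) := by
    intro t
    have hc : Integrable (fun x => conj (f x)) (stdGaussian E) :=
      (LinearIsometryEquiv.integrable_comp_iff (φ := f) Complex.conjLIE).2 hmem
    refine hc.mul_bdd (c := 1) (by fun_prop) (Filter.Eventually.of_forall fun x => ?_)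
    rw [Complex.norm_exp_ofReal_mul_I]
  have hre : (fun x => (f x).re) =ᵐ[stdGaussian E] 0 := by
    refine ae_eq_zero_of_integral_cexp_eq_zero hmem.re fun t => ?_
    have : ∀ x, (((f x).re : ℝ) : ℂ) * Complex.exp ((⟪x, t⟫ : ℝ) * Complex.I) =
        (1 / 2 : ℂ) * (f x * Complex.exp ((⟪x, t⟫ : ℝ) * Complex.I) +
          conj (f x) * Complex.exp ((⟪x, t⟫ : ℝ) * Complex.I)) := by
      intro x
      rw [Complex.re_eq_add_conj]
      ring
    simp_rw [this]
    rw [integral_const_mul, integral_add (hi t) (hi' t), h0, h0']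
    simp
  have him : (fun x => (f x).im) =ᵐ[stdGaussian E] 0 := by
    refine ae_eq_zero_of_integral_cexp_eq_zero hmem.im fun t => ?_
    have : ∀ x, (((f x).im : ℝ) : ℂ) * Complex.exp ((⟪x, t⟫ : ℝ) * Complex.I) =
        (1 / (2 * Complex.I) : ℂ) * (f x * Complex.exp ((⟪x, t⟫ : ℝ) * Complex.I) -
          conj (f x) * Complex.exp ((⟪x, t⟫ : ℝ) * Complex.I)) := by
      intro x
      rw [Complex.im_eq_sub_conj]
      ring
    simp_rw [this]
    rw [integral_const_mul, integral_sub (hi t) (hi' t), h0, h0']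
    simp
  rw [Lp.eq_zero_iff_ae_eq_zero]
  filter_upwards [hre, him] with x h1 h2
  exact Complex.ext h1 h2

end GaussianExponentials

/-! ### Bilinear forms diagonal in the chaos decomposition, and Mehler forms. -/

section MehlerForms

open scoped RealInnerProductSpace

variable {E : Type*} [NormedAddCommGroup E] [InnerProductSpace ℝ E] [FiniteDimensional ℝ E]
  [MeasurableSpace E] [BorelSpace E]

/-- The product of the coordinates of `s` along a finite sequence of basis vectors. -/
noncomputable def coordProd {ι : Type*} [Fintype ι] (b : OrthonormalBasis ι ℝ E) (k : ℕ)
    (f : Fin k → ι) (s : E) : ℝ := ∏ l, ⟪s, b (f l)⟫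

omit [FiniteDimensional ℝ E] [MeasurableSpace E] [BorelSpace E] in
theorem sum_coordProd_mul {ι : Type*} [Fintype ι] (b : OrthonormalBasis ι ℝ E) (k : ℕ) (s t : E) :
    ∑ f : Fin k → ι, coordProd b k f s * coordProd b k f t = ⟪s, t⟫ ^ k := by
  rw [← b.sum_inner_mul_inner s t, Fintype.sum_pow]
  refine Finset.sum_congr rfl fun f _ => ?_
  rw [coordProd, coordProd, ← Finset.prod_mul_distrib]
  refine Finset.prod_congr rfl fun l _ => ?_
  rw [real_inner_comm (b (f l)) t]

/-- A bilinear form whose values on exponentials are `∑ c_k ⟨s,t⟩^k / k!` is bounded on `L₂` by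
`sup |c_k|`. -/
theorem norm_apply_apply_le_of_hasSum_wave
    (B : Lp ℂ 2 (stdGaussian E) →L[ℂ] Lp ℂ 2 (stdGaussian E) →L[ℂ] ℂ) (c : ℕ → ℂ) {ε : ℝ}
    (hc : ∀ k, ‖c k‖ ≤ ε)
    (hB : ∀ s t : E, HasSum (fun k : ℕ => c k * (((⟪s, t⟫ ^ k : ℝ) : ℂ) / (k.factorial : ℂ)))
      (B (wave s) (wave t)))
    (a b : Lp ℂ 2 (stdGaussian E)) : ‖B a b‖ ≤ ε * (‖a‖ * ‖b‖) := by
  have hε : 0 ≤ ε := (norm_nonneg _).trans (hc 0)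
  set v := stdOrthonormalBasis ℝ E
  -- These are the coordinates of ∑ α_s s^{⊗k} in the tensor power basis. In terms of them both the
  -- form and the squared norm become sums over the degree k, with weights c_k/k! and 1/k!.
  let A : (k : ℕ) → (Fin k → Fin (Module.finrank ℝ E)) → (E →₀ ℂ) → ℂ :=
    fun k f α => ∑ s ∈ α.support, α s * (coordProd v k f s : ℂ)
  have hcomb : ∀ (α : E →₀ ℂ), (α.sum fun s z => z • wave s) = ∑ s ∈ α.support, α s • wave s :=
    fun α => rfl
  have hBsum : ∀ α β : E →₀ ℂ, HasSum
      (fun k : ℕ => c k * ((∑ f, A k f α * A k f β) / (k.factorial : ℂ)))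
      (B (α.sum fun s z => z • wave s) (β.sum fun s z => z • wave s)) := by
    intro α β
    have h1 : B (α.sum fun s z => z • wave s) (β.sum fun s z => z • wave s) =
        ∑ s ∈ α.support, ∑ t ∈ β.support, α s * β t * B (wave s) (wave t) := by
      rw [hcomb, hcomb]
      simp only [map_sum, map_smul, _root_.sum_apply, _root_.smul_apply,
        smul_eq_mul, Finset.mul_sum, mul_assoc]
      rw [Finset.sum_comm]
      refine Finset.sum_congr rfl fun s _ => Finset.sum_congr rfl fun t _ => ?_
      ring
    rw [h1]
    have h2 := hasSum_sum fun s (_ : s ∈ α.support) => hasSum_sum fun t (_ : t ∈ β.support) =>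
      (hB s t).mul_left (α s * β t)
    refine (congrArg (fun F => HasSum F _) (funext fun k => ?_)).mpr h2
    simp only [A, Finset.sum_mul_sum]
    rw [Finset.sum_comm, Finset.sum_div, Finset.mul_sum]
    refine Finset.sum_congr rfl fun s _ => ?_
    rw [Finset.sum_comm, Finset.sum_div, Finset.mul_sum]
    refine Finset.sum_congr rfl fun t _ => ?_
    rw [← sum_coordProd_mul v k s t, Complex.ofReal_sum, Finset.sum_div, Finset.sum_div,
      Finset.mul_sum, Finset.mul_sum, Finset.mul_sum]
    refine Finset.sum_congr rfl fun f _ => ?_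
    push_cast
    ring
  have hnorm : ∀ α : E →₀ ℂ, HasSum
      (fun k : ℕ => (∑ f, ‖A k f α‖ ^ 2) / (k.factorial : ℝ))
      (‖α.sum fun s z => z • wave s‖ ^ 2) := by
    intro α
    rw [← Complex.hasSum_ofReal]
    have h1 : ((‖α.sum fun s z => z • wave s‖ ^ 2 : ℝ) : ℂ) =
        ∑ s ∈ α.support, ∑ t ∈ α.support, conj (α s) * α t * Complex.exp (⟪s, t⟫ : ℝ) := by
      rw [Complex.ofReal_pow]
      have h0 : inner ℂ (α.sum fun s z => z • wave s) (α.sum fun s z => z • wave s) =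
          (‖α.sum fun s z => z • wave s‖ : ℂ) ^ 2 := inner_self_eq_norm_sq_to_K _
      rw [← h0, hcomb]
      simp only [sum_inner, inner_sum, inner_smul_left, inner_smul_right, inner_wave,
        Finset.mul_sum, mul_assoc]
      rw [Finset.sum_comm]
      refine Finset.sum_congr rfl fun s _ => Finset.sum_congr rfl fun t _ => ?_
      ring
    rw [h1]
    have hexp : ∀ x : ℝ, HasSum (fun k : ℕ => (((x ^ k : ℝ) : ℂ) / (k.factorial : ℂ)))
        (Complex.exp (x : ℝ)) := by
      intro x
      have := NormedSpace.expSeries_div_hasSum_exp (𝔸 := ℂ) (x : ℂ)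
      rw [← Complex.exp_eq_exp_ℂ] at this
      simpa using this
    have h2 := hasSum_sum fun s (_ : s ∈ α.support) => hasSum_sum fun t (_ : t ∈ α.support) =>
      (hexp ⟪s, t⟫).mul_left (conj (α s) * α t)
    refine (congrArg (fun F => HasSum F _) (funext fun k => ?_)).mpr h2
    have h3 : ∀ f, ((‖A k f α‖ ^ 2 : ℝ) : ℂ) = conj (A k f α) * A k f α := by
      intro f
      rw [Complex.conj_mul']
      push_cast
      rfl
    rw [Complex.ofReal_div, Complex.ofReal_sum]
    simp only [h3, A, map_sum, map_mul, Complex.conj_ofReal, Finset.sum_mul_sum]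
    rw [Finset.sum_comm, Finset.sum_div]
    refine Finset.sum_congr rfl fun s _ => ?_
    rw [Finset.sum_comm, Finset.sum_div]
    refine Finset.sum_congr rfl fun t _ => ?_
    rw [← sum_coordProd_mul v k s t, Complex.ofReal_sum, Finset.sum_div, Finset.sum_div,
      Finset.mul_sum]
    refine Finset.sum_congr rfl fun f _ => ?_
    push_cast
    ring
  -- The two series are compared term by term through |zw| ≤ (|z|² + |w|²)/2; the product of norms
  -- is recovered at the end by applying the bound to unit vectors.
  have hspan : ∀ x ∈ Submodule.span ℂ (Set.range (wave (E := E))),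
      ∀ y ∈ Submodule.span ℂ (Set.range (wave (E := E))),
      ‖B x y‖ ≤ ε * ((‖x‖ ^ 2 + ‖y‖ ^ 2) / 2) := by
    intro x hx y hy
    obtain ⟨α, rfl⟩ := Finsupp.mem_span_range_iff_exists_finsupp.1 hx
    obtain ⟨β, rfl⟩ := Finsupp.mem_span_range_iff_exists_finsupp.1 hy
    refine (hBsum α β).norm_le_of_bounded ((((hnorm α).add (hnorm β)).div_const 2).mul_left ε)
      fun k => ?_
    rw [norm_mul, norm_div, Complex.norm_natCast, ← add_div, div_right_comm]
    refine mul_le_mul (hc k) (div_le_div_of_nonneg_right ?_ (Nat.cast_nonneg _)) (by positivity) hε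
    refine (norm_sum_le _ _).trans ?_
    rw [← Finset.sum_add_distrib, Finset.sum_div]
    refine Finset.sum_le_sum fun f _ => ?_
    rw [norm_mul]
    nlinarith [sq_nonneg (‖A k f α‖ - ‖A k f β‖)]
  have hall : ∀ x y, ‖B x y‖ ≤ ε * ((‖x‖ ^ 2 + ‖y‖ ^ 2) / 2) := by
    have hd : Dense (Submodule.span ℂ (Set.range (wave (E := E))) : Set (Lp ℂ 2 (stdGaussian E))) :=
      Submodule.dense_iff_topologicalClosure_eq_top.2 dense_span_wave
    have hcl : IsClosed {z : Lp ℂ 2 (stdGaussian E) × Lp ℂ 2 (stdGaussian E) |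
        ‖B z.1 z.2‖ ≤ ε * ((‖z.1‖ ^ 2 + ‖z.2‖ ^ 2) / 2)} :=
      isClosed_le (by fun_prop) (by fun_prop)
    intro x y
    have h1 := (hcl.closure_subset_iff (s := (Submodule.span ℂ (Set.range (wave (E := E))) :
      Set (Lp ℂ 2 (stdGaussian E))) ×ˢ (Submodule.span ℂ (Set.range (wave (E := E))) :
      Set (Lp ℂ 2 (stdGaussian E))))).2 fun z hz => hspan _ hz.1 _ hz.2
    rw [(hd.prod hd).closure_eq] at h1
    exact h1 (Set.mem_univ (x, y))
  by_cases ha : a = 0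
  · simp [ha]
  by_cases hb : b = 0
  · simp [hb]
  have ha' : 0 < ‖a‖ := norm_pos_iff.2 ha
  have hb' : 0 < ‖b‖ := norm_pos_iff.2 hb
  have h1 := hall (((‖a‖⁻¹ : ℝ) : ℂ) • a) (((‖b‖⁻¹ : ℝ) : ℂ) • b)
  have hn : ∀ x : Lp ℂ 2 (stdGaussian E), 0 < ‖x‖ → ‖((‖x‖⁻¹ : ℝ) : ℂ) • x‖ = 1 := by
    intro x hx
    rw [norm_smul, Complex.norm_real, norm_inv, norm_norm, inv_mul_cancel₀ hx.ne']
  rw [hn a ha', hn b hb', map_smul, map_smul, _root_.smul_apply, norm_smul, norm_smul,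
    Complex.norm_real, Complex.norm_real, norm_inv, norm_inv, norm_norm, norm_norm] at h1
  have h2 : ‖B a b‖ = ‖a‖ * ‖b‖ * (‖b‖⁻¹ * (‖a‖⁻¹ * ‖B a b‖)) := by
    field_simp
  rw [h2]
  calc _ ≤ ‖a‖ * ‖b‖ * (ε * ((1 ^ 2 + 1 ^ 2) / 2)) := by
        refine mul_le_mul_of_nonneg_left ?_ (by positivity)
        linarith
    _ = _ := by ring

/-- The pairing `∫ f g` on `L₂`. -/
noncomputable def mulPairing {X : Type*} [MeasurableSpace X] (ν : Measure X) :
    Lp ℂ 2 ν →L[ℂ] Lp ℂ 2 ν →L[ℂ] ℂ :=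
  ContinuousLinearMap.lpPairing ν 2 2 (ContinuousLinearMap.mul ℂ ℂ)

theorem mulPairing_apply {X : Type*} [MeasurableSpace X] (ν : Measure X) (f g : Lp ℂ 2 ν) :
    mulPairing ν f g = ∫ x, f x * g x ∂ν :=
  ContinuousLinearMap.lpPairing_eq_integral _ f g

/-- The Mehler form `∫∫ a(x) b(ρ x + (1 - ρ²)^{1/2} y)`. -/
noncomputable def mehlerForm {ρ : ℝ} (hρ : ρ ^ 2 ≤ 1) :
    Lp ℂ 2 (stdGaussian E) →L[ℂ] Lp ℂ 2 (stdGaussian E) →L[ℂ] ℂ :=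
  (mulPairing ((stdGaussian E).prod (stdGaussian E))).bilinearComp
    (Lp.compMeasurePreservingₗᵢ ℂ Prod.fst measurePreserving_fst).toContinuousLinearMap
    (Lp.compMeasurePreservingₗᵢ ℂ (mehlerMap ρ)
      (measurePreserving_mehlerMap hρ)).toContinuousLinearMap

theorem mehlerForm_apply {ρ : ℝ} (hρ : ρ ^ 2 ≤ 1) (a b : Lp ℂ 2 (stdGaussian E)) :
    mehlerForm hρ a b =
      ∫ z, a z.1 * b (mehlerMap ρ z) ∂(stdGaussian E).prod (stdGaussian E) := by
  change mulPairing _ (Lp.compMeasurePreserving _ _ a) (Lp.compMeasurePreserving _ _ b) = _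
  rw [mulPairing_apply]
  refine integral_congr_ae ?_
  filter_upwards [Lp.coeFn_compMeasurePreserving a measurePreserving_fst,
    Lp.coeFn_compMeasurePreserving b (measurePreserving_mehlerMap hρ)] with z h1 h2
  rw [h1, h2]
  rfl

/-- The form is bilinear, with no conjugation, hence the sign: degree k carries the coefficient
(−ρ)^k. -/
theorem mehlerForm_wave {ρ : ℝ} (hρ : ρ ^ 2 ≤ 1) (s t : E) :
    mehlerForm hρ (wave s) (wave t) = Complex.exp ((-ρ * ⟪s, t⟫ : ℝ) : ℂ) := by
  rw [mehlerForm_apply]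
  have : ∀ᵐ z ∂(stdGaussian E).prod (stdGaussian E), wave s z.1 * wave t (mehlerMap ρ z) =
      Complex.exp (((‖s‖ : ℂ) ^ 2 + (‖t‖ : ℂ) ^ 2) / 2) *
      (Complex.exp ((⟪z.1, s⟫ : ℝ) * Complex.I) *
        Complex.exp ((⟪mehlerMap ρ z, t⟫ : ℝ) * Complex.I)) := by
    filter_upwards [measurePreserving_fst.quasiMeasurePreserving.ae (coeFn_wave s),
      (measurePreserving_mehlerMap hρ).quasiMeasurePreserving.ae (coeFn_wave t)] with z h1 h2
    rw [h1, h2, waveFun, waveFun, add_div, Complex.exp_add]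
    ring
  rw [integral_congr_ae this, integral_const_mul, integral_cexp_mehlerMap hρ, ← Complex.exp_add]
  congr 1
  push_cast
  ring

/-- Subtracting the form at −ρ leaves only odd degrees. After division by 2ρ, degree 1 cancels
against `D`, and an odd degree k ≥ 3 keeps the coefficient ρ^{k-1} ≤ ρ². -/
theorem norm_sub_mehlerForm_le
    (D : Lp ℂ 2 (stdGaussian E) →L[ℂ] Lp ℂ 2 (stdGaussian E) →L[ℂ] ℂ)
    (hD : ∀ s t : E, D (wave s) (wave t) = -(⟪s, t⟫ : ℝ)) {ρ : ℝ} (h0 : 0 < ρ) (hρ : ρ ^ 2 ≤ 1)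
    (hρ' : (-ρ) ^ 2 ≤ 1) (a b : Lp ℂ 2 (stdGaussian E)) :
    ‖D a b - ((2 * ρ : ℝ) : ℂ)⁻¹ * (mehlerForm hρ a b - mehlerForm hρ' a b)‖ ≤
      ρ ^ 2 * (‖a‖ * ‖b‖) := by
  have hρ1 : ρ ≤ 1 := by nlinarith
  let c : ℕ → ℝ := fun k => -(if k = 1 then 1 else 0) - (2 * ρ)⁻¹ * ((-ρ) ^ k - ρ ^ k)
  have hc : ∀ k, ‖(c k : ℂ)‖ ≤ ρ ^ 2 := by
    intro k
    rw [Complex.norm_real]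
    rcases Nat.even_or_odd' k with ⟨j, rfl | rfl⟩
    · have : 2 * j ≠ 1 := by omega
      simp [c, this]
      positivity
    · rcases j with _ | j
      · have : c (2 * 0 + 1) = 0 := by
          simp [c]
          field_simp
          ring
        rw [this]
        simp
        positivity
      · have h1 : 2 * (j + 1) + 1 ≠ 1 := by omega
        have : c (2 * (j + 1) + 1) = ρ ^ 2 * ρ ^ (2 * j) := by
          simp only [c, h1, if_false]
          rw [Odd.neg_pow ⟨j + 1, rfl⟩]
          field_simp
          ring
        rw [this, norm_mul, Real.norm_of_nonneg (by positivity), Real.norm_of_nonneg (by positivity)]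
        exact mul_le_of_le_one_right (by positivity) (pow_le_one₀ h0.le hρ1)
  have hexp : ∀ x : ℝ, HasSum (fun k : ℕ => (((x ^ k : ℝ) : ℂ) / (k.factorial : ℂ)))
      (Complex.exp (x : ℝ)) := by
    intro x
    have := NormedSpace.expSeries_div_hasSum_exp (𝔸 := ℂ) (x : ℂ)
    rw [← Complex.exp_eq_exp_ℂ] at this
    simpa using this
  set R : Lp ℂ 2 (stdGaussian E) →L[ℂ] Lp ℂ 2 (stdGaussian E) →L[ℂ] ℂ :=
    D - ((2 * ρ : ℝ) : ℂ)⁻¹ • (mehlerForm hρ - mehlerForm hρ') with hR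
  have := norm_apply_apply_le_of_hasSum_wave R (fun k => (c k : ℂ)) hc ?_ a b
  · simpa [hR] using this
  intro s t
  have h1 : R (wave s) (wave t) =
      -(⟪s, t⟫ : ℝ) - ((2 * ρ : ℝ) : ℂ)⁻¹ * (Complex.exp ((-ρ * ⟪s, t⟫ : ℝ) : ℂ) -
        Complex.exp ((ρ * ⟪s, t⟫ : ℝ) : ℂ)) := by
    have h2 := mehlerForm_wave hρ s t
    have h3 := mehlerForm_wave hρ' s t
    rw [neg_neg] at h3
    rw [← h2, ← h3, ← hD]
    rfl
  rw [h1]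
  have h4 : HasSum (fun k : ℕ => -(if k = 1 then ((⟪s, t⟫ : ℝ) : ℂ) else 0)) (-((⟪s, t⟫ : ℝ) : ℂ)) :=
    (hasSum_ite_eq 1 _).neg
  have h5 := h4.sub (((hexp (-ρ * ⟪s, t⟫)).sub (hexp (ρ * ⟪s, t⟫))).mul_left ((2 * ρ : ℝ) : ℂ)⁻¹)
  refine (congrArg (fun F => HasSum F _) (funext fun k => ?_)).mpr h5
  by_cases hk : k = 1
  · subst hk
    simp [c]
    ring
  · simp [c, hk, mul_pow]
    ring

end MehlerForms

/-! ### The conjugate adjoint of an L₁ contraction, on sup norms, tensors and square functions. -/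

section Adjoint

variable {X T : Type*} [MeasurableSpace X] [MeasurableSpace T] {μ : Measure X} {m : Measure T}

theorem coeFn_finset_sum_smul {p : ℝ≥0∞} {J : Type*} (s : Finset J) (c : J → ℂ)
    (f : J → Lp ℂ p μ) : ⇑(∑ j ∈ s, c j • f j) =ᵐ[μ] fun x => ∑ j ∈ s, c j * f j x := by
  classical
  induction s using Finset.induction_on with
  | empty =>
    filter_upwards [Lp.coeFn_zero ℂ p μ] with x hx
    rw [Finset.sum_empty, hx, Finset.sum_empty, Pi.zero_apply]
  | insert j s hj ih =>
    rw [Finset.sum_insert hj]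
    filter_upwards [ih, Lp.coeFn_add (c j • f j) (∑ j ∈ s, c j • f j),
      Lp.coeFn_smul (c j) (f j)] with x h1 h2 h3
    rw [h2, Pi.add_apply, h3, h1, Finset.sum_insert hj]
    rfl

theorem ae_norm_le_norm_of_memLp_top {F : Type*} [NormedAddCommGroup F] (f : Lp F ∞ m) :
    ∀ᵐ t ∂m, ‖f t‖ ≤ ‖f‖ := by
  filter_upwards [ae_le_eLpNormEssSup (f := f) (μ := m)] with t ht
  rw [Lp.norm_def, eLpNorm_exponent_top, ← toReal_enorm]
  refine ENNReal.toReal_mono ?_ ht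
  have := Lp.eLpNorm_ne_top f
  rwa [eLpNorm_exponent_top] at this

theorem norm_le_of_ae_norm_le [NeZero m] {F : Type*} [NormedAddCommGroup F] {f : Lp F ∞ m} {M : ℝ}
    (h : ∀ᵐ t ∂m, ‖f t‖ ≤ M) : ‖f‖ ≤ M := by
  have hM : 0 ≤ M := by
    obtain ⟨t, ht⟩ := h.exists
    exact (norm_nonneg _).trans ht
  rw [Lp.norm_def, eLpNorm_exponent_top]
  exact ENNReal.toReal_le_of_le_ofReal hM (eLpNormEssSup_le_of_ae_bound h)

/-- The inclusion of `L₂` in `L₁` over a probability space. -/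
noncomputable def inclL2L1 (μ : Measure X) [IsProbabilityMeasure μ] :
    Lp ℂ 2 μ →L[ℂ] Lp ℂ 1 μ :=
  LinearMap.mkContinuous
    { toFun := fun f => ((Lp.memLp f).mono_exponent one_le_two).toLp f
      map_add' := fun f g => by
        rw [← MemLp.toLp_add]
        exact MemLp.toLp_congr _ _ (Lp.coeFn_add f g)
      map_smul' := fun c f => by
        rw [RingHom.id_apply, ← MemLp.toLp_const_smul]
        exact MemLp.toLp_congr _ _ (Lp.coeFn_smul c f) } 1 fun f => by
    rw [one_mul]
    simp only [LinearMap.coe_mk, AddHom.coe_mk, Lp.norm_toLp]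
    rw [Lp.norm_def]
    exact ENNReal.toReal_mono (Lp.eLpNorm_ne_top f)
      (eLpNorm_le_eLpNorm_of_exponent_le one_le_two (Lp.aestronglyMeasurable f))

theorem coeFn_inclL2L1 [IsProbabilityMeasure μ] (f : Lp ℂ 2 μ) : inclL2L1 μ f =ᵐ[μ] f :=
  MemLp.coeFn_toLp ((Lp.memLp f).mono_exponent one_le_two)

/-- The pairing of `L_∞` and `L₁`. -/
noncomputable def topOnePairing (m : Measure T) : Lp ℂ ∞ m →L[ℂ] Lp ℂ 1 m →L[ℂ] ℂ :=
  ContinuousLinearMap.lpPairing m ∞ 1 (ContinuousLinearMap.mul ℂ ℂ)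

theorem topOnePairing_apply (h : Lp ℂ ∞ m) (f : Lp ℂ 1 m) :
    topOnePairing m h f = ∫ t, h t * f t ∂m :=
  ContinuousLinearMap.lpPairing_eq_integral _ h f

theorem norm_topOnePairing_le (h : Lp ℂ ∞ m) (f : Lp ℂ 1 m) :
    ‖topOnePairing m h f‖ ≤ ‖h‖ * ‖f‖ := by
  rw [topOnePairing_apply]
  calc ‖∫ t, h t * f t ∂m‖ ≤ ∫ t, ‖h‖ * ‖f t‖ ∂m := by
        refine norm_integral_le_of_norm_le ((L1.integrable_coeFn f).norm.const_mul _) ?_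
        filter_upwards [ae_norm_le_norm_of_memLp_top h] with t ht
        rw [norm_mul]
        exact mul_le_mul_of_nonneg_right ht (norm_nonneg _)
    _ = ‖h‖ * ‖f‖ := by rw [integral_const_mul, L1.norm_eq_integral_norm]

/-- A contraction of `L₁` spaces has an adjoint on `L_∞`, here with values in `L₂` and
conjugate linear. -/
noncomputable def conjAdjoint [IsProbabilityMeasure μ] (S : Lp ℂ 1 μ →L[ℂ] Lp ℂ 1 m) :
    Lp ℂ ∞ m →ₗ⋆[ℂ] Lp ℂ 2 μ where
  toFun h := (InnerProductSpace.toDual ℂ (Lp ℂ 2 μ)).symm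
    ((topOnePairing m h).comp (S.comp (inclL2L1 μ)))
  map_add' h k := by simp [ContinuousLinearMap.add_comp]
  map_smul' c h := by
    rw [map_smul, ContinuousLinearMap.smul_comp, LinearIsometryEquiv.map_smulₛₗ]

theorem inner_conjAdjoint [IsProbabilityMeasure μ] (S : Lp ℂ 1 μ →L[ℂ] Lp ℂ 1 m)
    (h : Lp ℂ ∞ m) (f : Lp ℂ 2 μ) :
    inner ℂ (conjAdjoint S h) f = topOnePairing m h (S (inclL2L1 μ f)) :=
  InnerProductSpace.toDual_symm_apply

/-- The adjoint is built in L₂ by Riesz, so the sup bound needs a test function: g·1_A with A = {|g|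
> ‖h‖}. It gives ∫_A |g|² ≤ ‖h‖ ∫_A |g|, which forces A to be null. -/
theorem ae_norm_conjAdjoint_le [IsProbabilityMeasure μ] {S : Lp ℂ 1 μ →L[ℂ] Lp ℂ 1 m}
    (hS : ‖S‖ ≤ 1) (h : Lp ℂ ∞ m) : ∀ᵐ x ∂μ, ‖conjAdjoint S h x‖ ≤ ‖h‖ := by
  set g := conjAdjoint S h with hg
  have hgm : StronglyMeasurable g := Lp.stronglyMeasurable g
  set A : Set X := {x | ‖h‖ < ‖g x‖} with hA
  have hAm : MeasurableSet A := measurableSet_lt measurable_const hgm.norm.measurable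
  have hmem : MemLp (A.indicator g) 2 μ := (Lp.memLp g).indicator hAm
  set f : Lp ℂ 2 μ := hmem.toLp _ with hf
  have hfc : f =ᵐ[μ] A.indicator g := hmem.coeFn_toLp
  have hsq : Integrable (fun x => ‖g x‖ ^ 2) μ := (Lp.memLp g).integrable_norm_pow two_ne_zero
  have hg1 : Integrable (fun x => ‖g x‖) μ := ((Lp.memLp g).integrable one_le_two).norm
  have h1 : inner ℂ g f = ((∫ x in A, ‖g x‖ ^ 2 ∂μ : ℝ) : ℂ) := by
    rw [L2.inner_def, ← integral_indicator hAm, ← integral_complex_ofReal]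
    refine integral_congr_ae ?_
    filter_upwards [hfc] with x hx
    rw [hx, RCLike.inner_apply]
    by_cases hxA : x ∈ A
    · rw [Set.indicator_of_mem hxA, Set.indicator_of_mem hxA, Complex.mul_conj']
      push_cast
      rfl
    · rw [Set.indicator_of_notMem hxA, Set.indicator_of_notMem hxA]
      simp
  have h2 : ‖inner ℂ g f‖ ≤ ‖h‖ * ∫ x in A, ‖g x‖ ∂μ := by
    rw [hg, inner_conjAdjoint]
    refine (norm_topOnePairing_le _ _).trans (mul_le_mul_of_nonneg_left ?_ (norm_nonneg _))
    refine (S.le_opNorm _).trans ((mul_le_of_le_one_left (norm_nonneg _) hS).trans ?_)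
    rw [L1.norm_eq_integral_norm, ← integral_indicator hAm]
    refine (integral_congr_ae ?_).le
    filter_upwards [coeFn_inclL2L1 f, hfc] with x h3 h4
    rw [h3, h4, norm_indicator_eq_indicator_norm]
  rw [h1, Complex.norm_real] at h2
  have h3 : ∫ x in A, (‖g x‖ ^ 2 - ‖h‖ * ‖g x‖) ∂μ ≤ 0 := by
    rw [integral_sub hsq.integrableOn (hg1.const_mul _).integrableOn, integral_const_mul]
    linarith [le_abs_self (∫ x in A, ‖g x‖ ^ 2 ∂μ), Real.norm_eq_abs (∫ x in A, ‖g x‖ ^ 2 ∂μ)]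
  have hpos : ∀ x ∈ A, 0 < ‖g x‖ ^ 2 - ‖h‖ * ‖g x‖ := by
    intro x hx
    have h4 : ‖h‖ < ‖g x‖ := hx
    nlinarith [norm_nonneg h]
  have h4 : μ A = 0 := by
    by_contra hne
    have := (setIntegral_pos_iff_support_of_nonneg_ae (μ := μ) (s := A)
      (f := fun x => ‖g x‖ ^ 2 - ‖h‖ * ‖g x‖)
      ((ae_restrict_iff' hAm).2 (Filter.Eventually.of_forall fun x hx => (hpos x hx).le))
      (hsq.sub (hg1.const_mul _)).integrableOn).2 (by
        have hsub : A ⊆ Function.support fun x => ‖g x‖ ^ 2 - ‖h‖ * ‖g x‖ :=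
          fun x hx => (hpos x hx).ne'
        rw [Set.inter_eq_right.2 hsub]
        exact pos_iff_ne_zero.2 hne)
    linarith
  have h5 : ∀ᵐ x ∂μ, x ∉ A := measure_eq_zero_iff_ae_notMem.1 h4
  filter_upwards [h5] with x hx
  exact not_lt.1 hx

theorem ae_norm_sum_conjAdjoint_le [NeZero m] [IsProbabilityMeasure μ]
    {S : Lp ℂ 1 μ →L[ℂ] Lp ℂ 1 m} (hS : ‖S‖ ≤ 1) {J : Type*} [Fintype J] (c : J → ℂ)
    (a : J → Lp ℂ ∞ m) {M : ℝ} (hM : ∀ᵐ t ∂m, ‖∑ j, c j * a j t‖ ≤ M) :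
    ∀ᵐ x ∂μ, ‖∑ j, conj (c j) * conjAdjoint S (a j) x‖ ≤ M := by
  have h1 : ‖∑ j, c j • a j‖ ≤ M := by
    refine norm_le_of_ae_norm_le ?_
    filter_upwards [hM, coeFn_finset_sum_smul Finset.univ c a] with t h2 h3
    rwa [h3]
  have h2 : conjAdjoint S (∑ j, c j • a j) = ∑ j, conj (c j) • conjAdjoint S (a j) := by
    rw [map_sum]
    exact Finset.sum_congr rfl fun j _ => LinearMap.map_smulₛₗ _ _ _
  filter_upwards [ae_norm_conjAdjoint_le hS (∑ j, c j • a j),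
    coeFn_finset_sum_smul Finset.univ (fun j => conj (c j)) fun j => conjAdjoint S (a j)]
    with x h3 h4
  rw [h2, h4] at h3
  exact h3.trans h1

theorem measurable_coeFn_Lp {p : ℝ≥0∞} (f : Lp ℂ p μ) : Measurable f :=
  (Lp.stronglyMeasurable f).measurable

theorem measurableSet_norm_sum_mul_le {J : Type*} [Fintype J] {M : ℝ} (c : J → ℂ) (f : J → X → ℂ)
    (g : J → T → ℂ) (hf : ∀ j, Measurable (f j)) (hg : ∀ j, Measurable (g j)) :
    MeasurableSet {p : X × T | ‖∑ j, c j * (f j p.1 * g j p.2)‖ ≤ M} := by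
  refine measurableSet_le (Measurable.norm (Finset.measurable_sum _ fun j _ => ?_))
    measurable_const
  exact (((hf j).comp measurable_fst).mul ((hg j).comp measurable_snd)).const_mul _

/-- If two (conjugate linear) maps do not increase the sup norms of linear combinations, then their
tensor product does not increase the sup norm of tensors. -/
theorem ae_norm_sum_mul_le_of_forall [SFinite m] [SFinite μ] {J : Type*} [Fintype J]
    {f g : J → T → ℂ} {F G : J → X → ℂ} (hf : ∀ j, Measurable (f j))
    (hF : ∀ j, Measurable (F j)) (hG : ∀ j, Measurable (G j)) {M : ℝ}
    (hfF : ∀ c : J → ℂ, (∀ᵐ t ∂m, ‖∑ j, c j * f j t‖ ≤ M) →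
      ∀ᵐ x ∂μ, ‖∑ j, conj (c j) * F j x‖ ≤ M)
    (hgG : ∀ c : J → ℂ, (∀ᵐ t ∂m, ‖∑ j, c j * g j t‖ ≤ M) →
      ∀ᵐ x ∂μ, ‖∑ j, conj (c j) * G j x‖ ≤ M)
    (c : J → ℂ) (hM : ∀ᵐ t ∂m.prod m, ‖∑ j, c j * (f j t.1 * g j t.2)‖ ≤ M) :
    ∀ᵐ x ∂μ.prod μ, ‖∑ j, conj (c j) * (F j x.1 * G j x.2)‖ ≤ M := by
  -- The second map is applied with t frozen, the quantifiers are exchanged by Fubini, and the first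
  -- map is applied with x frozen. Since the second map has conjugated f_j(t), a global conjugation
  -- is needed in between to return to linear combinations of the f_j.
  have h1 : ∀ᵐ t ∂m, ∀ᵐ x ∂μ, ‖∑ j, conj (c j) * (conj (f j t) * G j x)‖ ≤ M := by
    filter_upwards [Measure.ae_ae_of_ae_prod hM] with t ht
    have := hgG (fun j => c j * f j t) (by simpa only [mul_assoc] using ht)
    simpa only [map_mul, mul_assoc] using this
  have h2 : ∀ᵐ x ∂μ, ∀ᵐ t ∂m, ‖∑ j, conj (c j) * (conj (f j t) * G j x)‖ ≤ M :=
    (Measure.ae_ae_comm (measurableSet_norm_sum_mul_le (fun j => conj (c j))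
      (fun j t => conj (f j t)) G (fun j => Complex.continuous_conj.measurable.comp (hf j)) hG)).1 h1
  have h3 : ∀ᵐ x ∂μ, ∀ᵐ y ∂μ, ‖∑ j, conj (c j) * (F j y * G j x)‖ ≤ M := by
    filter_upwards [h2] with x hx
    have h4 : ∀ t, ∑ j, c j * conj (G j x) * f j t =
        conj (∑ j, conj (c j) * (conj (f j t) * G j x)) := by
      intro t
      rw [map_sum]
      refine Finset.sum_congr rfl fun j _ => ?_
      simp only [map_mul, Complex.conj_conj]
      ring
    have h5 := hfF (fun j => c j * conj (G j x)) (by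
      filter_upwards [hx] with t ht
      rwa [h4, Complex.norm_conj])
    filter_upwards [h5] with y hy
    have h6 : ∑ j, conj (c j) * (F j y * G j x) = ∑ j, conj (c j * conj (G j x)) * F j y := by
      refine Finset.sum_congr rfl fun j _ => ?_
      simp only [map_mul, Complex.conj_conj]
      ring
    rwa [h6]
  have h4 : ∀ᵐ x ∂μ, ∀ᵐ y ∂μ, ‖∑ j, conj (c j) * (F j x * G j y)‖ ≤ M := by
    refine (Measure.ae_ae_comm ?_).1 h3
    have := measurableSet_norm_sum_mul_le (M := M) (fun j => conj (c j)) G F hG hF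
    simpa only [mul_comm (G _ _)] using this
  exact (Measure.ae_prod_iff_ae_ae
    (measurableSet_norm_sum_mul_le (fun j => conj (c j)) F G hF hG)).2 h4

/-- The conjugate adjoint of a contraction is contractive on tensors, for the norm of `L_∞` of the
product. -/
theorem ae_norm_sum_conjAdjoint_mul_le [IsProbabilityMeasure m] [IsProbabilityMeasure μ]
    {S : Lp ℂ 1 μ →L[ℂ] Lp ℂ 1 m} (hS : ‖S‖ ≤ 1) {J : Type*} [Fintype J] (c : J → ℂ)
    (a b : J → Lp ℂ ∞ m) {M : ℝ}
    (hM : ∀ᵐ t ∂m.prod m, ‖∑ j, c j * (a j t.1 * b j t.2)‖ ≤ M) :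
    ∀ᵐ x ∂μ.prod μ,
      ‖∑ j, conj (c j) * (conjAdjoint S (a j) x.1 * conjAdjoint S (b j) x.2)‖ ≤ M :=
  ae_norm_sum_mul_le_of_forall (fun j => measurable_coeFn_Lp (a j))
    (fun j => measurable_coeFn_Lp (conjAdjoint S (a j)))
    (fun j => measurable_coeFn_Lp (conjAdjoint S (b j)))
    (fun c hc => ae_norm_sum_conjAdjoint_le hS c a hc)
    (fun c hc => ae_norm_sum_conjAdjoint_le hS c b hc) c hM

/-- The conjugate adjoint of a contraction is contractive on `ℓ₂`-valued functions. -/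
theorem sum_norm_sq_conjAdjoint_le [NeZero m] [IsProbabilityMeasure μ]
    {S : Lp ℂ 1 μ →L[ℂ] Lp ℂ 1 m} (hS : ‖S‖ ≤ 1) {J : Type*} [Fintype J]
    (a : J → Lp ℂ ∞ m) {K : ℝ} (hK0 : 0 ≤ K) (hK : ∀ᵐ t ∂m, ∑ j, ‖a j t‖ ^ 2 ≤ K ^ 2) :
    ∑ j, ‖conjAdjoint S (a j)‖ ^ 2 ≤ K ^ 2 := by
  have hCS : ∀ c z : EuclideanSpace ℂ J, ‖∑ j, c j * z j‖ ≤ ‖c‖ * ‖z‖ := by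
    intro c z
    calc ‖∑ j, c j * z j‖ ≤ ∑ j, ‖c j‖ * ‖z j‖ := by
          refine (norm_sum_le _ _).trans (le_of_eq ?_)
          simp only [norm_mul]
      _ ≤ ‖c‖ * ‖z‖ := by
          rw [EuclideanSpace.norm_eq, EuclideanSpace.norm_eq]
          exact Real.sum_mul_le_sqrt_mul_sqrt _ _ _
  -- Each vector c brings its own null set, so c first runs through a countable dense sequence.
  -- Continuity then gives every c at once, and c is taken to be the vector of values at x itself.
  have h1 : ∀ n : ℕ, ∀ᵐ x ∂μ,
      ‖∑ j, conj (TopologicalSpace.denseSeq (EuclideanSpace ℂ J) n j) * conjAdjoint S (a j) x‖ ≤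
        ‖TopologicalSpace.denseSeq (EuclideanSpace ℂ J) n‖ * K := by
    intro n
    refine ae_norm_sum_conjAdjoint_le hS _ a ?_
    filter_upwards [hK] with t ht
    refine (hCS _ (WithLp.toLp 2 fun j => a j t)).trans
      (mul_le_mul_of_nonneg_left ?_ (norm_nonneg _))
    rw [EuclideanSpace.norm_eq]
    exact Real.sqrt_le_iff.2 ⟨hK0, ht⟩
  have h2 : ∀ᵐ x ∂μ, ∑ j, ‖conjAdjoint S (a j) x‖ ^ 2 ≤ K ^ 2 := by
    filter_upwards [ae_all_iff.2 h1] with x hx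
    have h3 : ∀ c : EuclideanSpace ℂ J, ‖∑ j, conj (c j) * conjAdjoint S (a j) x‖ ≤ ‖c‖ * K := by
      intro c
      refine (TopologicalSpace.denseRange_denseSeq (EuclideanSpace ℂ J)).induction_on
        (p := fun c => ‖∑ j, conj (c j) * conjAdjoint S (a j) x‖ ≤ ‖c‖ * K) c ?_ hx
      refine isClosed_le ?_ (by fun_prop)
      refine (continuous_finsetSum _ fun j _ => ?_).norm
      exact (Complex.continuous_conj.comp (by fun_prop)).mul continuous_const
    have h4 := h3 (WithLp.toLp 2 fun j => conjAdjoint S (a j) x)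
    have h5 : ∑ j, conj (conjAdjoint S (a j) x) * conjAdjoint S (a j) x =
        ((∑ j, ‖conjAdjoint S (a j) x‖ ^ 2 : ℝ) : ℂ) := by
      rw [Complex.ofReal_sum]
      refine Finset.sum_congr rfl fun j _ => ?_
      rw [Complex.conj_mul']
      push_cast
      rfl
    simp only at h4
    rw [h5, Complex.norm_real, EuclideanSpace.norm_eq, Real.norm_of_nonneg (by positivity)] at h4
    simp only at h4
    set q := ∑ j, ‖conjAdjoint S (a j) x‖ ^ 2 with hq
    have hq0 : 0 ≤ q := by positivity
    have h6 : √q * √q = q := Real.mul_self_sqrt hq0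
    have h7 : √q ≤ K := by
      by_contra hlt
      push Not at hlt
      nlinarith [Real.sqrt_nonneg q]
    nlinarith [Real.sqrt_nonneg q]
  have h3 : ∀ f : Lp ℂ 2 μ, ‖f‖ ^ 2 = ∫ x, ‖f x‖ ^ 2 ∂μ := by
    intro f
    have h4 : inner ℂ f f = (‖f‖ : ℂ) ^ 2 := inner_self_eq_norm_sq_to_K _
    rw [L2.inner_def] at h4
    have h5 : ∫ x, inner ℂ (f x) (f x) ∂μ = ((∫ x, ‖f x‖ ^ 2 ∂μ : ℝ) : ℂ) := by
      rw [← integral_complex_ofReal]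
      refine integral_congr_ae (Filter.Eventually.of_forall fun x => ?_)
      have h6 : inner ℂ (f x) (f x) = (‖f x‖ : ℂ) ^ 2 := inner_self_eq_norm_sq_to_K _
      simp only [h6]
      push_cast
      rfl
    rw [h5] at h4
    exact_mod_cast h4.symm
  have hint : ∀ f : Lp ℂ 2 μ, Integrable (fun x => ‖f x‖ ^ 2) μ := fun f =>
    (Lp.memLp f).integrable_norm_pow two_ne_zero
  simp only [h3]
  rw [← integral_finsetSum _ fun j _ => hint _]
  calc _ ≤ ∫ _, K ^ 2 ∂μ :=
        integral_mono_ae (integrable_finsetSum _ fun j _ => hint _) (integrable_const _) h2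
    _ = K ^ 2 := by simp

end Adjoint

/-! ### Singular values, and the operator norm against rows and columns. -/

section Matrices

open scoped ComplexOrder in
/-- Singular value decomposition of a square matrix; the singular values sum to `tr |x|`. -/
theorem exists_singularValueDecomposition {k : ℕ} (x : Mat k) :
    ∃ (A B : Mat k) (l : Fin k → ℝ), Aᴴ * A = 1 ∧ B * Bᴴ = 1 ∧ (∀ i, 0 ≤ l i) ∧
      x = A * Matrix.diagonal (fun i => (l i : ℂ)) * B ∧ ∑ i, l i = traceAbs x := by
  have hp : (CFC.abs x).PosSemidef := Matrix.nonneg_iff_posSemidef.1 (CFC.abs_nonneg x)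
  have hH := hp.isHermitian
  set U : Mat k := (hH.eigenvectorUnitary : Mat k)
  set l := hH.eigenvalues with hl
  have hUU : Uᴴ * U = 1 := Unitary.coe_star_mul_self hH.eigenvectorUnitary
  have hUU' : U * Uᴴ = 1 := Unitary.coe_mul_star_self hH.eigenvectorUnitary
  have hspec : CFC.abs x = U * Matrix.diagonal (fun i => (l i : ℂ)) * Uᴴ := by
    conv_lhs => rw [hH.spectral_theorem]
    rw [Unitary.conjStarAlgAut_apply]
    rfl
  set Y : Mat k := x * U with hY
  have hYY : Yᴴ * Y = Matrix.diagonal (fun i => ((l i * l i : ℝ) : ℂ)) := by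
    have h1 : xᴴ * x = CFC.abs x * CFC.abs x := (CFC.abs_mul_abs x).symm
    calc Yᴴ * Y = Uᴴ * (xᴴ * x) * U := by
          rw [hY, Matrix.conjTranspose_mul]
          simp only [Matrix.mul_assoc]
      _ = (Uᴴ * U) * Matrix.diagonal (fun i => (l i : ℂ)) * (Uᴴ * U) *
            Matrix.diagonal (fun i => (l i : ℂ)) * (Uᴴ * U) := by
          rw [h1, hspec]
          simp only [Matrix.mul_assoc]
      _ = _ := by
          rw [hUU, Matrix.one_mul, Matrix.mul_one, Matrix.mul_one, Matrix.diagonal_mul_diagonal]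
          simp
  -- The left singular vectors. Where l_i = 0 the inverse is 0 and the vector is discarded: the
  -- basis extension supplies another one, harmless because that column of Y vanishes.
  let w : Fin k → EuclideanSpace ℂ (Fin k) := fun i =>
    WithLp.toLp 2 fun a => ((l i)⁻¹ : ℂ) * Y a i
  have hinner : ∀ i j, inner ℂ (w i) (w j) = ((l i)⁻¹ : ℂ) * ((l j)⁻¹ : ℂ) * (Yᴴ * Y) i j := by
    intro i j
    simp only [w, PiLp.inner_apply, RCLike.inner_apply, Matrix.mul_apply,
      Matrix.conjTranspose_apply, Finset.mul_sum, map_mul, map_inv₀, Complex.conj_ofReal]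
    refine Finset.sum_congr rfl fun a _ => ?_
    rw [starRingEnd_apply]
    ring
  have horth : Orthonormal ℂ (({i | l i ≠ 0} : Set (Fin k)).domRestrict w) := by
    rw [orthonormal_iff_ite]
    rintro ⟨i, hi⟩ ⟨j, hj⟩
    rw [Set.domRestrict_apply, Set.domRestrict_apply, hinner, hYY, Matrix.diagonal_apply]
    simp only [Subtype.mk.injEq]
    by_cases hij : i = j
    · subst hij
      have hi' : (l i : ℂ) ≠ 0 := Complex.ofReal_ne_zero.2 hi
      simp only [if_true]
      push_cast
      field_simp
    · simp [hij]
  obtain ⟨b, hb⟩ := horth.exists_orthonormalBasis_extension_of_card_eq (by simp)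
  let A : Mat k := Matrix.of fun a i => b i a
  have hAA : Aᴴ * A = 1 := by
    ext i j
    have h1 := orthonormal_iff_ite.1 b.orthonormal i j
    rw [PiLp.inner_apply] at h1
    rw [Matrix.one_apply, ← h1, Matrix.mul_apply]
    refine Finset.sum_congr rfl fun a _ => ?_
    simp [A, mul_comm]
  have hYA : Y = A * Matrix.diagonal (fun i => (l i : ℂ)) := by
    ext a i
    rw [Matrix.mul_diagonal]
    by_cases hi : l i = 0
    · have h1 : ∑ c, star (Y c i) * Y c i = 0 := by
        have h2 := congrFun (congrFun hYY i) i
        rw [Matrix.mul_apply] at h2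
        simpa [hi] using h2
      have h2 : ∑ c, ‖Y c i‖ ^ 2 = 0 := by
        rw [← Complex.ofReal_inj, Complex.ofReal_zero, ← h1, Complex.ofReal_sum]
        refine Finset.sum_congr rfl fun c _ => ?_
        rw [← starRingEnd_apply, Complex.conj_mul']
        push_cast
        rfl
      have h3 := (Finset.sum_eq_zero_iff_of_nonneg fun c _ => by positivity).1 h2 a
        (Finset.mem_univ a)
      rw [hi]
      simpa using h3
    · have hi' : (l i : ℂ) ≠ 0 := Complex.ofReal_ne_zero.2 hi
      have : A a i = w i a := by
        simp only [A, Matrix.of_apply]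
        rw [hb i hi]
      rw [this]
      simp only [w]
      field_simp
  refine ⟨A, Uᴴ, l, hAA, ?_, hp.eigenvalues_nonneg, ?_, ?_⟩
  · rw [Matrix.conjTranspose_conjTranspose, hUU]
  · rw [← hYA, hY, Matrix.mul_assoc, hUU', Matrix.mul_one]
  · rw [traceAbs, hH.trace_eq_sum_eigenvalues]
    simp [hl]

theorem sum_norm_sq_col_le {k : ℕ} (M : Mat k) (i : Fin k) : ∑ c, ‖M c i‖ ^ 2 ≤ ‖M‖ ^ 2 := by
  have h := Matrix.l2_opNorm_mulVec M (EuclideanSpace.single i (1 : ℂ))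
  rw [PiLp.norm_single, norm_one, mul_one] at h
  have h2 := pow_le_pow_left₀ (norm_nonneg _) h 2
  rw [EuclideanSpace.norm_sq_eq] at h2
  simpa using h2

theorem sum_norm_sq_row_le {k : ℕ} (M : Mat k) (i : Fin k) : ∑ c, ‖M i c‖ ^ 2 ≤ ‖M‖ ^ 2 := by
  have := sum_norm_sq_col_le Mᴴ i
  simpa [Matrix.l2_opNorm_conjTranspose] using this

theorem norm_le_one_of_conjTranspose_mul_self {k : ℕ} {A : Mat k} (hA : Aᴴ * A = 1) : ‖A‖ ≤ 1 := by
  have h1 := Matrix.l2_opNorm_conjTranspose_mul_self A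
  rw [hA] at h1
  have h2 : ‖(1 : Mat k)‖ ≤ 1 := by
    rcases Nat.eq_zero_or_pos k with rfl | hk
    · rw [Subsingleton.elim (1 : Mat 0) 0, norm_zero]
      exact zero_le_one
    · have : Nonempty (Fin k) := ⟨⟨0, hk⟩⟩
      exact CStarRing.norm_one.le
  nlinarith [norm_nonneg A]

end Matrices

/-! ### Splitting a rotated first chaos form into a Mehler part and a small remainder. -/

section MehlerDecomposition

open scoped RealInnerProductSpace

variable {E : Type*} [NormedAddCommGroup E] [InnerProductSpace ℝ E] [FiniteDimensional ℝ E]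
  [MeasurableSpace E] [BorelSpace E]

theorem measurePreserving_stdGaussian (σ : E ≃ₗᵢ[ℝ] E) :
    MeasurePreserving σ (stdGaussian E) (stdGaussian E) :=
  ⟨σ.continuous.measurable, stdGaussian_map σ⟩

/-- Composition with a linear isometry on the `L₂` space of the Gaussian measure. -/
noncomputable def compIsometry (σ : E ≃ₗᵢ[ℝ] E) :
    Lp ℂ 2 (stdGaussian E) →L[ℂ] Lp ℂ 2 (stdGaussian E) :=
  (Lp.compMeasurePreservingₗᵢ ℂ σ (measurePreserving_stdGaussian σ)).toContinuousLinearMap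

theorem coeFn_compIsometry (σ : E ≃ₗᵢ[ℝ] E) (f : Lp ℂ 2 (stdGaussian E)) :
    compIsometry σ f =ᵐ[stdGaussian E] f ∘ σ :=
  Lp.coeFn_compMeasurePreserving f (measurePreserving_stdGaussian σ)

theorem norm_compIsometry (σ : E ≃ₗᵢ[ℝ] E) (f : Lp ℂ 2 (stdGaussian E)) :
    ‖compIsometry σ f‖ = ‖f‖ :=
  Lp.norm_compMeasurePreserving f (measurePreserving_stdGaussian σ)

theorem compIsometry_wave (σ : E ≃ₗᵢ[ℝ] E) (t : E) :
    compIsometry σ (wave t) = wave (σ.symm t) := by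
  refine Lp.ext ?_
  filter_upwards [coeFn_compIsometry σ (wave t), coeFn_wave (σ.symm t),
    (measurePreserving_stdGaussian σ).quasiMeasurePreserving.ae (coeFn_wave t)] with x h1 h2 h3
  rw [h1, h2, Function.comp_apply, h3, waveFun, waveFun, LinearIsometryEquiv.norm_map,
    ← σ.inner_map_map x, σ.apply_symm_apply]

theorem compIsometry_compIsometry_symm (σ : E ≃ₗᵢ[ℝ] E) (f : Lp ℂ 2 (stdGaussian E)) :
    compIsometry σ (compIsometry σ.symm f) = f := by
  refine Lp.ext ?_
  filter_upwards [coeFn_compIsometry σ (compIsometry σ.symm f),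
    (measurePreserving_stdGaussian σ).quasiMeasurePreserving.ae (coeFn_compIsometry σ.symm f)]
    with x h1 h2
  rw [h1, Function.comp_apply, h2, Function.comp_apply, σ.symm_apply_apply]

/-- The sum is the integral of the tensor along the pair (x, σ⁻¹(ρx + √(1−ρ²) y)). The strict
inequality ρ² < 1 makes the law of this pair absolutely continuous, so the almost everywhere bound
survives. -/
theorem norm_sum_mehlerForm_le {ρ : ℝ} (hρ : ρ ^ 2 ≤ 1) (hρ' : ρ ^ 2 < 1) (σ : E ≃ₗᵢ[ℝ] E)
    {J : Type*} [Fintype J] (c : J → ℂ) (f g : J → Lp ℂ 2 (stdGaussian E)) {M : ℝ}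
    (hM : ∀ᵐ x ∂(stdGaussian E).prod (stdGaussian E), ‖∑ j, c j * (f j x.1 * g j x.2)‖ ≤ M) :
    ‖∑ j, c j * mehlerForm hρ (f j) (compIsometry σ.symm (g j))‖ ≤ M := by
  set P := (stdGaussian E).prod (stdGaussian E)
  have hs : √(1 - ρ ^ 2) ≠ 0 := (Real.sqrt_pos.2 (by linarith)).ne'
  have hq : Measure.QuasiMeasurePreserving (fun z : E × E => (z.1, σ.symm (mehlerMap ρ z))) P P := by
    have h1 := quasiMeasurePreserving_prodMk_add_smul (E := E) ρ hs
    have h2 := (MeasurePreserving.id (stdGaussian E)).prod (measurePreserving_stdGaussian σ.symm)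
    exact h2.quasiMeasurePreserving.comp h1
  have hae : ∀ j, ∀ᵐ z ∂P, compIsometry σ.symm (g j) (mehlerMap ρ z) =
      g j (σ.symm (mehlerMap ρ z)) := fun j =>
    (measurePreserving_mehlerMap hρ).quasiMeasurePreserving.ae (coeFn_compIsometry σ.symm (g j))
  have hint : ∀ j, Integrable
      (fun z : E × E => f j z.1 * compIsometry σ.symm (g j) (mehlerMap ρ z)) P := fun j =>
    ((Lp.memLp (f j)).comp_measurePreserving measurePreserving_fst).integrable_mul
      ((Lp.memLp (compIsometry σ.symm (g j))).comp_measurePreserving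
        (measurePreserving_mehlerMap hρ))
  have h1 : ∑ j, c j * mehlerForm hρ (f j) (compIsometry σ.symm (g j)) =
      ∫ z, ∑ j, c j * (f j z.1 * compIsometry σ.symm (g j) (mehlerMap ρ z)) ∂P := by
    rw [integral_finsetSum _ fun j _ => (hint j).const_mul _]
    refine Finset.sum_congr rfl fun j _ => ?_
    rw [integral_const_mul, mehlerForm_apply]
  rw [h1]
  have h2 := norm_integral_le_of_norm_le_const (μ := P) (C := M)
    (f := fun z => ∑ j, c j * (f j z.1 * compIsometry σ.symm (g j) (mehlerMap ρ z))) (by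
      filter_upwards [hq.ae hM, ae_all_iff.2 hae] with z h2 h3
      simpa only [h3] using h2)
  simpa using h2

/-- A bilinear form given by an isometry on the first chaos is the sum of a form which is bounded by
`1 / ρ` for the sup norm of tensors and of a form which is bounded by `ρ²` on `L₂`. -/
theorem exists_remainder_of_wave
    (D : Lp ℂ 2 (stdGaussian E) →L[ℂ] Lp ℂ 2 (stdGaussian E) →L[ℂ] ℂ) (σ : E ≃ₗᵢ[ℝ] E)
    (hD : ∀ s t : E, D (wave s) (wave t) = -(⟪s, σ t⟫ : ℝ)) {ρ : ℝ} (h0 : 0 < ρ) (h1 : ρ < 1) :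
    ∃ R : Lp ℂ 2 (stdGaussian E) →L[ℂ] Lp ℂ 2 (stdGaussian E) →L[ℂ] ℂ,
      (∀ f g, ‖R f g‖ ≤ ρ ^ 2 * (‖f‖ * ‖g‖)) ∧
      ∀ (J : Type) [Fintype J] (c : J → ℂ) (f g : J → Lp ℂ 2 (stdGaussian E)) (M : ℝ),
        (∀ᵐ x ∂(stdGaussian E).prod (stdGaussian E), ‖∑ j, c j * (f j x.1 * g j x.2)‖ ≤ M) →
        ‖∑ j, c j * D (f j) (g j) - ∑ j, c j * R (f j) (g j)‖ ≤ M / ρ := by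
  have hρ' : ρ ^ 2 < 1 := by nlinarith
  have hρ : ρ ^ 2 ≤ 1 := hρ'.le
  have hm' : (-ρ) ^ 2 < 1 := by rwa [neg_sq]
  have hm : (-ρ) ^ 2 ≤ 1 := hm'.le
  set N : Lp ℂ 2 (stdGaussian E) →L[ℂ] Lp ℂ 2 (stdGaussian E) →L[ℂ] ℂ :=
    ((2 * ρ : ℝ) : ℂ)⁻¹ • (mehlerForm hρ - mehlerForm hm).bilinearComp
      (ContinuousLinearMap.id ℂ _) (compIsometry σ.symm) with hN
  have hNa : ∀ f g, N f g = ((2 * ρ : ℝ) : ℂ)⁻¹ * (mehlerForm hρ f (compIsometry σ.symm g) -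
      mehlerForm hm f (compIsometry σ.symm g)) := fun f g => rfl
  refine ⟨D - N, fun f g => ?_, fun J _ c f g M hM => ?_⟩
  -- Composing the second variable with σ untwists `D` into the form with values −⟨s,t⟩ on waves;
  -- the composition preserves the L₂ norm.
  · have key := norm_sub_mehlerForm_le (D.bilinearComp (ContinuousLinearMap.id ℂ _)
      (compIsometry σ)) (fun s t => by
        rw [ContinuousLinearMap.bilinearComp_apply, compIsometry_wave, ContinuousLinearMap.id_apply,
          hD, σ.apply_symm_apply]) h0 hρ hm f (compIsometry σ.symm g)
    rw [ContinuousLinearMap.bilinearComp_apply, compIsometry_compIsometry_symm, norm_compIsometry]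
      at key
    exact key
  · have h2 : ∑ j, c j * D (f j) (g j) - ∑ j, c j * (D - N) (f j) (g j) =
        ((2 * ρ : ℝ) : ℂ)⁻¹ * (∑ j, c j * mehlerForm hρ (f j) (compIsometry σ.symm (g j)) -
          ∑ j, c j * mehlerForm hm (f j) (compIsometry σ.symm (g j))) := by
      rw [← Finset.sum_sub_distrib, ← Finset.sum_sub_distrib, Finset.mul_sum]
      refine Finset.sum_congr rfl fun j _ => ?_
      rw [_root_.sub_apply, _root_.sub_apply, hNa]
      ring
    rw [h2, norm_mul, norm_inv, Complex.norm_real, Real.norm_of_nonneg (by positivity)]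
    have h3 := norm_sum_mehlerForm_le hρ hρ' σ c f g hM
    have h4 := norm_sum_mehlerForm_le hm hm' σ c f g hM
    calc _ ≤ (2 * ρ)⁻¹ * (M + M) :=
          mul_le_mul_of_nonneg_left ((norm_sub_le _ _).trans (add_le_add h3 h4)) (by positivity)
      _ = M / ρ := by field_simp; ring

end MehlerDecomposition

/-! ### From i.i.d. complex Gaussians to the standard Gaussian vector. -/

section ComplexGaussian

open scoped RealInnerProductSpace

/-- Real and imaginary parts have variance 1/2, whereas the standard Gaussian of the underlying real
space gives them variance 1. This is the origin of every factor √2 below. -/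
theorem charFun_stdComplexGaussian (z : ℂ) :
    charFun stdComplexGaussian z = Complex.exp (-((‖z‖ ^ 2 / 4 : ℝ) : ℂ)) := by
  rw [charFun_apply, stdComplexGaussian, integral_map (by fun_prop) (by fun_prop)]
  have h1 : ∀ p : ℝ × ℝ, Complex.exp
      ((⟪(((√2)⁻¹ : ℝ) : ℂ) * ((p.1 : ℂ) + (p.2 : ℂ) * Complex.I), z⟫ : ℝ) * Complex.I) =
      Complex.exp (((√2)⁻¹ * z.re : ℝ) * p.1 * Complex.I) *
        Complex.exp (((√2)⁻¹ * z.im : ℝ) * p.2 * Complex.I) := by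
    intro p
    rw [← Complex.exp_add, Complex.inner]
    congr 1
    have : (z * (starRingEnd ℂ) ((((√2)⁻¹ : ℝ) : ℂ) * ((p.1 : ℂ) + (p.2 : ℂ) * Complex.I))).re =
        (√2)⁻¹ * z.re * p.1 + (√2)⁻¹ * z.im * p.2 := by
      simp [-Complex.ofReal_inv]
      ring
    rw [this]
    push_cast
    ring
  simp_rw [h1]
  rw [integral_prod_mul (fun x : ℝ => Complex.exp (((√2)⁻¹ * z.re : ℝ) * x * Complex.I))
    (fun x : ℝ => Complex.exp (((√2)⁻¹ * z.im : ℝ) * x * Complex.I)), ← charFun_apply_real,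
    ← charFun_apply_real, charFun_gaussianReal, charFun_gaussianReal, ← Complex.exp_add]
  congr 1
  have h2 : (√2)⁻¹ ^ 2 = (1 / 2 : ℝ) := by
    rw [inv_pow, Real.sq_sqrt (by norm_num)]
    norm_num
  have h3 : ‖z‖ ^ 2 = z.re ^ 2 + z.im ^ 2 := by
    rw [← Complex.normSq_eq_norm_sq, Complex.normSq_apply]
    ring
  have h4 : ((√2)⁻¹ * z.re) ^ 2 / 2 + ((√2)⁻¹ * z.im) ^ 2 / 2 = ‖z‖ ^ 2 / 4 := by
    rw [mul_pow, mul_pow, h2, h3]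
    ring
  rw [← h4]
  push_cast
  ring

variable {Ω : Type*} [MeasurableSpace Ω] {P : Measure Ω} [IsProbabilityMeasure P]
  {I : Type} [Fintype I]

instance : IsProbabilityMeasure stdComplexGaussian :=
  Measure.isProbabilityMeasure_map (by fun_prop)

/-- Independent normalized complex Gaussian variables as a standard Gaussian vector. -/
theorem measurePreserving_stdGaussian_of_iIndepFun {γ : I → Ω → ℂ} (hm : ∀ p, Measurable (γ p))
    (hlaw : ∀ p, HasLaw (γ p) stdComplexGaussian P) (hind : iIndepFun γ P) :
    MeasurePreserving (fun ω => √2 • (WithLp.toLp 2 fun p => γ p ω : EuclideanSpace ℂ I)) P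
      (stdGaussian (EuclideanSpace ℂ I)) := by
  have hmeas : Measurable fun ω => (WithLp.toLp 2 fun p => γ p ω : EuclideanSpace ℂ I) :=
    (WithLp.measurable_toLp 2 _).comp (measurable_pi_lambda _ hm)
  refine ⟨hmeas.const_smul √2, ?_⟩
  have h1 : P.map (fun ω p => γ p ω) = Measure.pi fun _ : I => stdComplexGaussian := by
    rw [(iIndepFun_iff_map_fun_eq_pi_map fun p => (hm p).aemeasurable).1 hind]
    congr 1
    funext p
    exact (hlaw p).map_eq
  have h2 : P.map (fun ω => √2 • (WithLp.toLp 2 fun p => γ p ω : EuclideanSpace ℂ I)) =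
      ((Measure.pi fun _ : I => stdComplexGaussian).map (WithLp.toLp 2)).map
        fun x : EuclideanSpace ℂ I => √2 • x := by
    rw [← h1, Measure.map_map (by fun_prop) (measurable_pi_lambda _ hm),
      Measure.map_map (by fun_prop) (by fun_prop)]
    rfl
  have : IsProbabilityMeasure
      (P.map (fun ω => √2 • (WithLp.toLp 2 fun p => γ p ω : EuclideanSpace ℂ I))) :=
    Measure.isProbabilityMeasure_map (hmeas.const_smul √2).aemeasurable
  refine Measure.ext_of_charFun (funext fun t => ?_)
  rw [h2, charFun_map_smul, charFun_pi, charFun_stdGaussian]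
  simp only [charFun_stdComplexGaussian]
  rw [← Complex.exp_sum, ← Complex.ofReal_pow, EuclideanSpace.norm_sq_eq]
  congr 1
  push_cast
  rw [neg_div, Finset.sum_div, Finset.sum_neg_distrib]
  congr 1
  refine Finset.sum_congr rfl fun p _ => ?_
  rw [PiLp.smul_apply, norm_smul, Real.norm_of_nonneg (Real.sqrt_nonneg _)]
  rw [← Complex.ofReal_pow, ← Complex.ofReal_pow, mul_pow, Real.sq_sqrt (by norm_num)]
  push_cast
  ring

end ComplexGaussian

/-! ### Pairings with the complex coordinates and their conjugates. -/

section FirstChaos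

open scoped RealInnerProductSpace

variable {I : Type} [Fintype I]

theorem memLp_coord (p : I) :
    MemLp (fun x : EuclideanSpace ℂ I => x p) 2 (stdGaussian (EuclideanSpace ℂ I)) := by
  refine (IsGaussian.memLp_two_id (μ := stdGaussian (EuclideanSpace ℂ I))).of_le
    (by fun_prop) (Filter.Eventually.of_forall fun x => ?_)
  exact PiLp.norm_apply_le x p

theorem memLp_conj_coord (p : I) :
    MemLp (fun x : EuclideanSpace ℂ I => conj (x p)) 2 (stdGaussian (EuclideanSpace ℂ I)) :=
  (memLp_coord p).of_le (Complex.continuous_conj.comp (by fun_prop)).aestronglyMeasurable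
    (Filter.Eventually.of_forall fun x => (Complex.norm_conj _).le)

/-- The coordinate functions in `L₂`. -/
noncomputable def coord (p : I) : Lp ℂ 2 (stdGaussian (EuclideanSpace ℂ I)) :=
  (memLp_coord p).toLp _

/-- The functional `f ↦ ∫ x_p f`. -/
noncomputable def coordPairing (p : I) :
    Lp ℂ 2 (stdGaussian (EuclideanSpace ℂ I)) →L[ℂ] ℂ :=
  mulPairing _ (coord p)

/-- The functional `f ↦ ∫ conj(x_p) f`. -/
noncomputable def conjCoordPairing (p : I) :
    Lp ℂ 2 (stdGaussian (EuclideanSpace ℂ I)) →L[ℂ] ℂ :=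
  mulPairing _ ((memLp_conj_coord p).toLp _)

theorem integrable_coord_mul_wave [DecidableEq I] (p : I) (c : ℂ) (t : EuclideanSpace ℂ I) :
    Integrable (fun x : EuclideanSpace ℂ I => ((⟪x, PiLp.single 2 p c⟫ : ℝ) : ℂ) * wave t x)
      (stdGaussian (EuclideanSpace ℂ I)) := by
  have h := ((integrable_inner_stdGaussian
    (PiLp.single 2 p c : EuclideanSpace ℂ I)).ofReal (𝕜 := ℂ)).mul_bdd
    (c := Real.exp (‖t‖ ^ 2 / 2)) (g := wave t) (Lp.aestronglyMeasurable _) (by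
      filter_upwards [coeFn_wave t] with x hx
      rw [hx, norm_waveFun])
  exact h

theorem real_inner_single (x : EuclideanSpace ℂ I) [DecidableEq I] (p : I) (c : ℂ) :
    ⟪x, PiLp.single 2 p c⟫ = (c * conj (x p)).re := by
  rw [PiLp.inner_apply, Finset.sum_eq_single p]
  · simp [Complex.inner]
  · intro q _ hq
    simp [hq]
  · simp

/-- Write x_p = ⟨x, e_p⟩ + i⟨x, i e_p⟩ for the real inner product and use the first moments of
waves. -/
theorem coordPairing_wave (p : I) (t : EuclideanSpace ℂ I) :
    coordPairing p (wave t) = Complex.I * t p := by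
  classical
  rw [coordPairing, mulPairing_apply]
  have h : ∀ᵐ x ∂stdGaussian (EuclideanSpace ℂ I), coord p x * wave t x =
      ((⟪x, PiLp.single 2 p 1⟫ : ℝ) : ℂ) * wave t x +
        Complex.I * (((⟪x, PiLp.single 2 p Complex.I⟫ : ℝ) : ℂ) * wave t x) := by
    filter_upwards [(memLp_coord p).coeFn_toLp] with x hx
    rw [coord, hx, real_inner_single, real_inner_single, ← mul_assoc, ← add_mul]
    congr 1
    apply Complex.ext <;> simp
  rw [integral_congr_ae h, integral_add (integrable_coord_mul_wave p 1 t)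
    ((integrable_coord_mul_wave p _ t).const_mul _), integral_const_mul, integral_inner_mul_wave,
    integral_inner_mul_wave, real_inner_comm, real_inner_comm t, real_inner_single,
    real_inner_single]
  apply Complex.ext <;> simp

theorem conjCoordPairing_wave (p : I) (t : EuclideanSpace ℂ I) :
    conjCoordPairing p (wave t) = Complex.I * conj (t p) := by
  classical
  rw [conjCoordPairing, mulPairing_apply]
  have h : ∀ᵐ x ∂stdGaussian (EuclideanSpace ℂ I),
      (memLp_conj_coord p).toLp _ x * wave t x =
      ((⟪x, PiLp.single 2 p 1⟫ : ℝ) : ℂ) * wave t x -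
        Complex.I * (((⟪x, PiLp.single 2 p Complex.I⟫ : ℝ) : ℂ) * wave t x) := by
    filter_upwards [(memLp_conj_coord p).coeFn_toLp] with x hx
    rw [hx, real_inner_single, real_inner_single, ← mul_assoc, ← sub_mul]
    congr 1
    apply Complex.ext <;> simp
  rw [integral_congr_ae h, integral_sub (integrable_coord_mul_wave p 1 t)
    ((integrable_coord_mul_wave p _ t).const_mul _), integral_const_mul, integral_inner_mul_wave,
    integral_inner_mul_wave, real_inner_comm, real_inner_comm t, real_inner_single,
    real_inner_single]
  apply Complex.ext <;> simp

end FirstChaos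

/-! ### The first chaos forms attached to unitary matrices. -/

section MatrixChaos

open scoped RealInnerProductSpace

variable {N : ℕ} {d : Fin N → ℕ}

/-- The indices `(n, a, b, c)` of the terms of `∑_n tr(x_n y_n z_n)`. -/
abbrev TripleIndex {N : ℕ} (d : Fin N → ℕ) : Type :=
  Σ n : Fin N, Fin (d n) × Fin (d n) × Fin (d n)

theorem sum_tripleIndex {R : Type*} [AddCommMonoid R] (F : TripleIndex d → R) :
    ∑ j, F j = ∑ n, ∑ a, ∑ b, ∑ c, F ⟨n, a, b, c⟩ := by
  rw [Fintype.sum_sigma]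
  simp only [Fintype.sum_prod_type]

theorem sum_entryIndex {R : Type*} [AddCommMonoid R] (F : EntryIndex d → R) :
    ∑ q, F q = ∑ n, ∑ b, ∑ c, F ⟨n, b, c⟩ := by
  rw [Fintype.sum_sigma]
  simp only [Fintype.sum_prod_type]

/-- The index of the second factor `y(b,c)` in `tr(x y z)`. -/
def TripleIndex.fst (j : TripleIndex d) : EntryIndex d := ⟨j.1, j.2.2.1, j.2.2.2⟩

/-- The index of the third factor `z(c,a)` in `tr(x y z)`. -/
def TripleIndex.snd (j : TripleIndex d) : EntryIndex d := ⟨j.1, j.2.2.2, j.2.1⟩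

theorem norm_sq_mulVec_of_conjTranspose_mul_self {k : ℕ} {A : Mat k} (hA : Aᴴ * A = 1)
    (v : Fin k → ℂ) : ∑ b, ‖∑ a, A b a * v a‖ ^ 2 = ∑ a, ‖v a‖ ^ 2 := by
  have h : ∀ w : Fin k → ℂ, ((∑ a, ‖w a‖ ^ 2 : ℝ) : ℂ) = star w ⬝ᵥ w := by
    intro w
    rw [Complex.ofReal_sum]
    refine Finset.sum_congr rfl fun a _ => ?_
    rw [Pi.star_apply, ← starRingEnd_apply, Complex.conj_mul']
    push_cast
    rfl
  have h2 : star (A *ᵥ v) ⬝ᵥ (A *ᵥ v) = star v ⬝ᵥ v := by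
    rw [Matrix.star_mulVec, ← Matrix.dotProduct_mulVec, Matrix.mulVec_mulVec, hA, Matrix.one_mulVec]
  rw [← h, ← h] at h2
  exact_mod_cast h2

/-- The real isometry `y ↦ w ȳ` (up to transpositions) of the space of families of matrices. -/
noncomputable def antiIsometry (w : (n : Fin N) → Mat (d n)) (hw : ∀ n, w n * (w n)ᴴ = 1) :
    EuclideanSpace ℂ (EntryIndex d) ≃ₗᵢ[ℝ] EuclideanSpace ℂ (EntryIndex d) :=
  LinearIsometry.toLinearIsometryEquiv
    { toFun := fun t => WithLp.toLp 2 fun q =>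
        ∑ a, w q.1 a q.2.1 * conj (t ⟨q.1, q.2.2, a⟩)
      map_add' := fun s t => by
        ext q
        simp [mul_add, Finset.sum_add_distrib]
      map_smul' := fun r t => by
        ext q
        simp only [PiLp.smul_apply, Complex.real_smul, map_mul, Complex.conj_ofReal,
          RingHom.id_apply, Finset.mul_sum]
        exact Finset.sum_congr rfl fun a _ => by ring
      norm_map' := fun t => by
        rw [← sq_eq_sq₀ (norm_nonneg _) (norm_nonneg _), EuclideanSpace.norm_sq_eq,
          EuclideanSpace.norm_sq_eq, sum_entryIndex, sum_entryIndex]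
        refine Finset.sum_congr rfl fun n _ => ?_
        rw [Finset.sum_comm]
        refine Finset.sum_congr rfl fun c _ => ?_
        have hT : ((w n)ᵀ)ᴴ * (w n)ᵀ = 1 := by
          have h1 : (w n)ᴴ * w n = 1 := mul_eq_one_comm.1 (hw n)
          have h2 : w n * (w n)ᴴ = 1 := hw n
          have h3 := congrArg Matrix.transpose h2
          rw [Matrix.transpose_mul, Matrix.transpose_one] at h3
          rw [← h3]
          rfl
        have h4 := norm_sq_mulVec_of_conjTranspose_mul_self hT fun a => conj (t ⟨n, c, a⟩)
        simpa using h4 } rfl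

theorem antiIsometry_apply (w : (n : Fin N) → Mat (d n)) (hw : ∀ n, w n * (w n)ᴴ = 1)
    (t : EuclideanSpace ℂ (EntryIndex d)) (q : EntryIndex d) :
    antiIsometry w hw t q = ∑ a, w q.1 a q.2.1 * conj (t ⟨q.1, q.2.2, a⟩) := rfl

/-- The bilinear form `½ ∑ w_n(a,b) (∫ x̄_n(b,c) f) (∫ x̄_n(c,a) g)`. -/
noncomputable def conjChaosForm (w : (n : Fin N) → Mat (d n)) :
    Lp ℂ 2 (stdGaussian (EuclideanSpace ℂ (EntryIndex d))) →L[ℂ]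
      Lp ℂ 2 (stdGaussian (EuclideanSpace ℂ (EntryIndex d))) →L[ℂ] ℂ :=
  ∑ j : TripleIndex d, (w j.1 j.2.1 j.2.2.1 / 2) •
    (ContinuousLinearMap.mul ℂ ℂ).bilinearComp (conjCoordPairing j.fst) (conjCoordPairing j.snd)

/-- The bilinear form `½ ∑ conj(w_n(a,b)) (∫ x_n(b,c) f) (∫ x_n(c,a) g)`. -/
noncomputable def chaosForm (w : (n : Fin N) → Mat (d n)) :
    Lp ℂ 2 (stdGaussian (EuclideanSpace ℂ (EntryIndex d))) →L[ℂ]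
      Lp ℂ 2 (stdGaussian (EuclideanSpace ℂ (EntryIndex d))) →L[ℂ] ℂ :=
  ∑ j : TripleIndex d, (conj (w j.1 j.2.1 j.2.2.1) / 2) •
    (ContinuousLinearMap.mul ℂ ℂ).bilinearComp (coordPairing j.fst) (coordPairing j.snd)

theorem conjChaosForm_apply (w : (n : Fin N) → Mat (d n))
    (f g : Lp ℂ 2 (stdGaussian (EuclideanSpace ℂ (EntryIndex d)))) :
    conjChaosForm w f g = ∑ j : TripleIndex d, (w j.1 j.2.1 j.2.2.1 / 2) *
      (conjCoordPairing j.fst f * conjCoordPairing j.snd g) := by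
  simp [conjChaosForm, _root_.sum_apply]

theorem chaosForm_apply (w : (n : Fin N) → Mat (d n))
    (f g : Lp ℂ 2 (stdGaussian (EuclideanSpace ℂ (EntryIndex d)))) :
    chaosForm w f g = ∑ j : TripleIndex d, (conj (w j.1 j.2.1 j.2.2.1) / 2) *
      (coordPairing j.fst f * coordPairing j.snd g) := by
  simp [chaosForm, _root_.sum_apply]

/-- On waves the two forms take the values −Z/2 and −conj(Z)/2. Their sum −Re Z is a real inner
product with a real isometry, the shape required by `exists_remainder_of_wave`. -/
theorem chaosForm_add_conj_wave (w : (n : Fin N) → Mat (d n)) (hw : ∀ n, w n * (w n)ᴴ = 1)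
    (s t : EuclideanSpace ℂ (EntryIndex d)) :
    (conjChaosForm w + chaosForm w) (wave s) (wave t) = -(⟪s, antiIsometry w hw t⟫ : ℝ) := by
  have h1 : conjChaosForm w (wave s) (wave t) =
      -(1 / 2) * ∑ j : TripleIndex d, w j.1 j.2.1 j.2.2.1 * (conj (s j.fst) * conj (t j.snd)) := by
    rw [conjChaosForm_apply, Finset.mul_sum]
    refine Finset.sum_congr rfl fun j _ => ?_
    rw [conjCoordPairing_wave, conjCoordPairing_wave]
    linear_combination (w j.1 j.2.1 j.2.2.1 / 2 * conj (s j.fst) * conj (t j.snd)) * Complex.I_mul_I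
  have h2 : chaosForm w (wave s) (wave t) =
      -(1 / 2) * conj (∑ j : TripleIndex d,
        w j.1 j.2.1 j.2.2.1 * (conj (s j.fst) * conj (t j.snd))) := by
    rw [chaosForm_apply, map_sum, Finset.mul_sum]
    refine Finset.sum_congr rfl fun j _ => ?_
    rw [coordPairing_wave, coordPairing_wave]
    simp only [map_mul, Complex.conj_conj]
    linear_combination (conj (w j.1 j.2.1 j.2.2.1) / 2 * s j.fst * t j.snd) * Complex.I_mul_I
  have h3 : ⟪s, antiIsometry w hw t⟫ =
      (∑ j : TripleIndex d, w j.1 j.2.1 j.2.2.1 * (conj (s j.fst) * conj (t j.snd))).re := by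
    rw [PiLp.inner_apply, sum_entryIndex, sum_tripleIndex, Complex.re_sum]
    refine Finset.sum_congr rfl fun n _ => ?_
    simp only [Complex.inner, antiIsometry_apply, TripleIndex.fst, TripleIndex.snd, ← Complex.re_sum,
      Finset.sum_mul]
    congr 1
    have h4 : ∀ F : Fin (d n) → Fin (d n) → Fin (d n) → ℂ,
        ∑ b, ∑ c, ∑ a, F a b c = ∑ a, ∑ b, ∑ c, F a b c := by
      intro F
      calc ∑ b, ∑ c, ∑ a, F a b c = ∑ b, ∑ a, ∑ c, F a b c :=
            Finset.sum_congr rfl fun b _ => Finset.sum_comm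
        _ = _ := Finset.sum_comm
    rw [h4]
    refine Finset.sum_congr rfl fun a _ => Finset.sum_congr rfl fun b _ =>
      Finset.sum_congr rfl fun c _ => ?_
    ring
  rw [_root_.add_apply, _root_.add_apply, h1, h2, h3, Complex.re_eq_add_conj]
  ring

/-- Polarization: replacing w by iw multiplies `conjChaosForm` by i and `chaosForm` by −i. With D(w)
the sum of the two forms, `conjChaosForm w` is therefore ½(D(w) − i D(iw)), and this average
preserves both bounds. -/
theorem exists_remainder_conjChaosForm (w : (n : Fin N) → Mat (d n)) (hw : ∀ n, w n * (w n)ᴴ = 1)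
    {ρ : ℝ} (h0 : 0 < ρ) (h1 : ρ < 1) :
    ∃ R : Lp ℂ 2 (stdGaussian (EuclideanSpace ℂ (EntryIndex d))) →L[ℂ]
        Lp ℂ 2 (stdGaussian (EuclideanSpace ℂ (EntryIndex d))) →L[ℂ] ℂ,
      (∀ f g, ‖R f g‖ ≤ ρ ^ 2 * (‖f‖ * ‖g‖)) ∧
      ∀ (J : Type) [Fintype J] (c : J → ℂ)
        (f g : J → Lp ℂ 2 (stdGaussian (EuclideanSpace ℂ (EntryIndex d)))) (M : ℝ),
        (∀ᵐ x ∂(stdGaussian (EuclideanSpace ℂ (EntryIndex d))).prod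
          (stdGaussian (EuclideanSpace ℂ (EntryIndex d))),
          ‖∑ j, c j * (f j x.1 * g j x.2)‖ ≤ M) →
        ‖∑ j, c j * conjChaosForm w (f j) (g j) - ∑ j, c j * R (f j) (g j)‖ ≤ M / ρ := by
  set w' : (n : Fin N) → Mat (d n) := fun n => Complex.I • w n with hw'd
  have hw' : ∀ n, w' n * (w' n)ᴴ = 1 := by
    intro n
    rw [hw'd]
    simp only [Matrix.conjTranspose_smul, Matrix.smul_mul, Matrix.mul_smul, smul_smul, hw]
    simp
  obtain ⟨R₁, hR₁, hM₁⟩ := exists_remainder_of_wave _ _ (chaosForm_add_conj_wave w hw) h0 h1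
  obtain ⟨R₂, hR₂, hM₂⟩ := exists_remainder_of_wave _ _ (chaosForm_add_conj_wave w' hw') h0 h1
  have hQ : ∀ f g, conjChaosForm w f g = (1 / 2 : ℂ) * ((conjChaosForm w + chaosForm w) f g -
      Complex.I * (conjChaosForm w' + chaosForm w') f g) := by
    intro f g
    have e1 : conjChaosForm w' f g = Complex.I * conjChaosForm w f g := by
      rw [conjChaosForm_apply, conjChaosForm_apply, Finset.mul_sum]
      refine Finset.sum_congr rfl fun j _ => ?_
      simp only [hw'd, Matrix.smul_apply, smul_eq_mul]
      ring
    have e2 : chaosForm w' f g = -Complex.I * chaosForm w f g := by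
      rw [chaosForm_apply, chaosForm_apply, Finset.mul_sum]
      refine Finset.sum_congr rfl fun j _ => ?_
      simp only [hw'd, Matrix.smul_apply, smul_eq_mul, map_mul, Complex.conj_I]
      ring
    simp only [_root_.add_apply, e1, e2]
    linear_combination (-(1 / 2 : ℂ) * (chaosForm w f g - conjChaosForm w f g)) * Complex.I_mul_I
  have hR : ∀ f g, ((1 / 2 : ℂ) • (R₁ - Complex.I • R₂)) f g =
      (1 / 2 : ℂ) * (R₁ f g - Complex.I * R₂ f g) := fun f g => rfl
  have hhalf : ∀ y z : ℂ, ∀ B : ℝ, ‖y‖ ≤ B → ‖z‖ ≤ B →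
      ‖(1 / 2 : ℂ) * (y - Complex.I * z)‖ ≤ B := by
    intro y z B hy hz
    rw [norm_mul]
    have h2 : ‖(1 / 2 : ℂ)‖ = 1 / 2 := by norm_num
    have h3 := norm_sub_le y (Complex.I * z)
    rw [norm_mul, Complex.norm_I, one_mul] at h3
    rw [h2]
    linarith
  refine ⟨(1 / 2 : ℂ) • (R₁ - Complex.I • R₂), fun f g => ?_, fun J _ c f g M hM => ?_⟩
  · rw [hR]
    exact hhalf _ _ _ (hR₁ f g) (hR₂ f g)
  · have := hhalf _ _ _ (hM₁ J c f g M hM) (hM₂ J c f g M hM)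
    refine le_trans (le_of_eq ?_) this
    congr 1
    simp only [hQ, hR]
    simp only [mul_sub, Finset.mul_sum, Finset.sum_sub_distrib]
    simp only [mul_left_comm]
    ring

end MatrixChaos

/-! ### Estimates for the images of the entries of ψ. -/

section Sidon

/-- The singular value decomposition turns the sum into ∑_i l_i ∑_c R((Bh)_{ic}, (hA)_{ci}), where
the inner sum costs at most εK. The trace norm of x thus appears, with no loss in the dimension
beyond K. -/
theorem norm_sum_trilinear_le {H : Type*} [NormedAddCommGroup H] [NormedSpace ℂ H]
    (R : H →L[ℂ] H →L[ℂ] ℂ) {ε K : ℝ} (hε : 0 ≤ ε) (hR : ∀ f g, ‖R f g‖ ≤ ε * (‖f‖ * ‖g‖))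
    {k : ℕ} {x A B : Mat k} {l : Fin k → ℝ} (hl : ∀ i, 0 ≤ l i)
    (hx : x = A * Matrix.diagonal (fun i => (l i : ℂ)) * B) (h : Fin k → Fin k → H)
    (hrow : ∀ i, ∑ c, ‖∑ b, B i b • h b c‖ ^ 2 ≤ K)
    (hcol : ∀ i, ∑ c, ‖∑ a, A a i • h c a‖ ^ 2 ≤ K) :
    ‖∑ a, ∑ b, ∑ c, x a b * R (h b c) (h c a)‖ ≤ ε * K * ∑ i, l i := by
  have h1 : ∑ a, ∑ b, ∑ c, x a b * R (h b c) (h c a) =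
      ∑ i, (l i : ℂ) * ∑ c, R (∑ b, B i b • h b c) (∑ a, A a i • h c a) := by
    have h2 : ∀ a b, x a b = ∑ i, A a i * l i * B i b := by
      intro a b
      rw [hx, Matrix.mul_apply]
      simp only [Matrix.mul_diagonal]
    simp only [h2, map_sum, map_smul, _root_.sum_apply, _root_.smul_apply, smul_eq_mul,
      Finset.mul_sum, Finset.sum_mul]
    calc _ = ∑ a, ∑ b, ∑ i, ∑ c, A a i * l i * B i b * R (h b c) (h c a) :=
          Finset.sum_congr rfl fun a _ => Finset.sum_congr rfl fun b _ => Finset.sum_comm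
      _ = ∑ a, ∑ i, ∑ b, ∑ c, A a i * l i * B i b * R (h b c) (h c a) :=
          Finset.sum_congr rfl fun a _ => Finset.sum_comm
      _ = ∑ i, ∑ a, ∑ b, ∑ c, A a i * l i * B i b * R (h b c) (h c a) := Finset.sum_comm
      _ = ∑ i, ∑ a, ∑ c, ∑ b, A a i * l i * B i b * R (h b c) (h c a) :=
          Finset.sum_congr rfl fun i _ => Finset.sum_congr rfl fun a _ => Finset.sum_comm
      _ = ∑ i, ∑ c, ∑ a, ∑ b, A a i * l i * B i b * R (h b c) (h c a) :=
          Finset.sum_congr rfl fun i _ => Finset.sum_comm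
      _ = _ := by
          refine Finset.sum_congr rfl fun i _ => Finset.sum_congr rfl fun c _ =>
            Finset.sum_congr rfl fun a _ => Finset.sum_congr rfl fun b _ => ?_
          ring
  rw [h1, Finset.mul_sum]
  refine (norm_sum_le _ _).trans (Finset.sum_le_sum fun i _ => ?_)
  rw [norm_mul, Complex.norm_real, Real.norm_of_nonneg (hl i), mul_comm]
  refine mul_le_mul_of_nonneg_right ?_ (hl i)
  refine (norm_sum_le _ _).trans ?_
  calc _ ≤ ∑ c, ε * ((‖∑ b, B i b • h b c‖ ^ 2 + ‖∑ a, A a i • h c a‖ ^ 2) / 2) := by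
        refine Finset.sum_le_sum fun c _ => (hR _ _).trans (mul_le_mul_of_nonneg_left ?_ hε)
        nlinarith [sq_nonneg (‖∑ b, B i b • h b c‖ - ‖∑ a, A a i • h c a‖)]
    _ = ε * ((∑ c, ‖∑ b, B i b • h b c‖ ^ 2 + ∑ c, ‖∑ a, A a i • h c a‖ ^ 2) / 2) := by
        rw [← Finset.mul_sum, ← Finset.sum_div, Finset.sum_add_distrib]
    _ ≤ ε * K := by
        refine mul_le_mul_of_nonneg_left ?_ hε
        linarith [hrow i, hcol i]

theorem TripleIndex.ext_fst_snd {N : ℕ} {d : Fin N → ℕ} {i j : TripleIndex d}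
    (h1 : i.fst = j.fst) (h2 : i.snd = j.snd) : i = j := by
  obtain ⟨n, a, b, c⟩ := i
  obtain ⟨n', a', b', c'⟩ := j
  simp only [TripleIndex.fst, TripleIndex.snd, Sigma.mk.injEq] at h1 h2
  obtain ⟨rfl, h1⟩ := h1
  simp_all

variable {N : ℕ} {d : Fin N → ℕ}

/-- The two entry indices together determine the triple, so one term survives; the factor ½ in the
form absorbs √2·√2. -/
theorem conjChaosForm_of_biorthogonal (w : (n : Fin N) → Mat (d n))
    (h : EntryIndex d → Lp ℂ 2 (stdGaussian (EuclideanSpace ℂ (EntryIndex d))))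
    (hh : ∀ p q, conjCoordPairing p (h q) = if p = q then (√2 : ℂ) else 0) (j : TripleIndex d) :
    conjChaosForm w (h j.fst) (h j.snd) = w j.1 j.2.1 j.2.2.1 := by
  rw [conjChaosForm_apply, Finset.sum_eq_single j]
  · rw [hh, hh, if_pos rfl, if_pos rfl, ← Complex.ofReal_mul, Real.mul_self_sqrt (by norm_num)]
    push_cast
    ring
  · intro i _ hij
    rw [hh, hh]
    by_cases h1 : i.fst = j.fst
    · by_cases h2 : i.snd = j.snd
      · exact absurd (TripleIndex.ext_fst_snd h1 h2) hij
      · simp [h2]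
    · simp [h1]
  · simp

variable {T : Type*} [MeasurableSpace T] {m : Measure T}

theorem memLp_conj_normalizedEntry (ψ : (n : Fin N) → Lp (Mat (d n)) ∞ m) (q : EntryIndex d) :
    MemLp (fun t => conj (normalizedEntry (fun n t => ψ n t) q t)) ∞ m := by
  have hc : Continuous fun M : Mat (d q.1) => conj (((√(d q.1 : ℝ) : ℝ) : ℂ) * M q.2.1 q.2.2) :=
    Complex.continuous_conj.comp (continuous_const.mul (continuous_id.matrix_elem _ _))
  refine memLp_top_of_bound (hc.comp_aestronglyMeasurable (Lp.aestronglyMeasurable (ψ q.1)))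
    (√(d q.1 : ℝ) * ‖ψ q.1‖) ?_
  filter_upwards [ae_norm_le_norm_of_memLp_top (ψ q.1)] with t ht
  rw [normalizedEntry, Complex.norm_conj, norm_mul, Complex.norm_real,
    Real.norm_of_nonneg (Real.sqrt_nonneg _)]
  refine mul_le_mul_of_nonneg_left (le_trans ?_ ht) (Real.sqrt_nonneg _)
  have h1 := sum_norm_sq_col_le (ψ q.1 t) q.2.2
  have h2 : ‖ψ q.1 t q.2.1 q.2.2‖ ^ 2 ≤ ∑ c, ‖ψ q.1 t c q.2.2‖ ^ 2 :=
    Finset.single_le_sum (f := fun c => ‖ψ q.1 t c q.2.2‖ ^ 2) (fun c _ => by positivity)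
      (Finset.mem_univ q.2.1)
  exact le_of_sq_le_sq (h2.trans h1) (norm_nonneg _)

/-- The conjugates of the normalized entries, in `L_∞`. -/
noncomputable def conjEntry (ψ : (n : Fin N) → Lp (Mat (d n)) ∞ m) (q : EntryIndex d) : Lp ℂ ∞ m :=
  (memLp_conj_normalizedEntry ψ q).toLp _

theorem coeFn_conjEntry (ψ : (n : Fin N) → Lp (Mat (d n)) ∞ m) :
    ∀ᵐ t ∂m, ∀ q, conjEntry ψ q t = conj (normalizedEntry (fun n t => ψ n t) q t) :=
  ae_all_iff.2 fun q => (memLp_conj_normalizedEntry ψ q).coeFn_toLp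

section Estimates

variable [IsProbabilityMeasure m] {X : Type*} [MeasurableSpace X] {μ : Measure X}
  [IsProbabilityMeasure μ]

/-- A row of Bψ_n(t) has ℓ₂ norm at most C', and the conjugate adjoint respects this square function
bound. The normalization √d_n produces d_n, exactly the weight of tr|x_n| in the Sidon sum. -/
theorem sum_norm_sq_row_conjAdjoint_le {S : Lp ℂ 1 μ →L[ℂ] Lp ℂ 1 m} (hS : ‖S‖ ≤ 1)
    (ψ : (n : Fin N) → Lp (Mat (d n)) ∞ m) {C' : ℝ} {n : Fin N} (hψ : ‖ψ n‖ ≤ C') {B : Mat (d n)}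
    (hB : ‖B‖ ≤ 1) (i : Fin (d n)) :
    ∑ c, ‖∑ b, B i b • conjAdjoint S (conjEntry ψ ⟨n, b, c⟩)‖ ^ 2 ≤ d n * C' ^ 2 := by
  have hC : 0 ≤ C' := (norm_nonneg _).trans hψ
  have h1 : ∀ c, ∑ b, B i b • conjAdjoint S (conjEntry ψ ⟨n, b, c⟩) =
      conjAdjoint S (∑ b, conj (B i b) • conjEntry ψ ⟨n, b, c⟩) := by
    intro c
    rw [map_sum]
    refine Finset.sum_congr rfl fun b _ => ?_
    rw [LinearMap.map_smulₛₗ, Complex.conj_conj]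
  have hK : (√(d n : ℝ) * C') ^ 2 = d n * C' ^ 2 := by
    rw [mul_pow, Real.sq_sqrt (Nat.cast_nonneg _)]
  simp only [h1]
  rw [← hK]
  refine sum_norm_sq_conjAdjoint_le hS _ (by positivity) ?_
  filter_upwards [ae_all_iff.2 fun c => coeFn_finset_sum_smul Finset.univ (fun b => conj (B i b))
    (fun b => conjEntry ψ ⟨n, b, c⟩), coeFn_conjEntry ψ, ae_norm_le_norm_of_memLp_top (ψ n)]
    with t h2 h3 h4
  have h5 : ∀ c, ‖(∑ b, conj (B i b) • conjEntry ψ ⟨n, b, c⟩ : Lp ℂ ∞ m) t‖ =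
      √(d n : ℝ) * ‖(B * ψ n t) i c‖ := by
    intro c
    have h6 : (∑ b, conj (B i b) • conjEntry ψ ⟨n, b, c⟩ : Lp ℂ ∞ m) t =
        conj (((√(d n : ℝ) : ℝ) : ℂ) * (B * ψ n t) i c) := by
      rw [h2, Matrix.mul_apply, Finset.mul_sum, map_sum]
      refine Finset.sum_congr rfl fun b _ => ?_
      rw [h3, normalizedEntry]
      simp only [map_mul]
      ring
    rw [h6, Complex.norm_conj, norm_mul, Complex.norm_real,
      Real.norm_of_nonneg (Real.sqrt_nonneg _)]
  simp only [h5, mul_pow]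
  rw [← Finset.mul_sum]
  refine mul_le_mul_of_nonneg_left ((sum_norm_sq_row_le _ i).trans ?_) (by positivity)
  refine pow_le_pow_left₀ (norm_nonneg _) ((Matrix.l2_opNorm_mul _ _).trans ?_) 2
  calc ‖B‖ * ‖ψ n t‖ ≤ 1 * C' := mul_le_mul hB (h4.trans hψ) (norm_nonneg _) zero_le_one
    _ = C' := one_mul _

theorem sum_norm_sq_col_conjAdjoint_le {S : Lp ℂ 1 μ →L[ℂ] Lp ℂ 1 m} (hS : ‖S‖ ≤ 1)
    (ψ : (n : Fin N) → Lp (Mat (d n)) ∞ m) {C' : ℝ} {n : Fin N} (hψ : ‖ψ n‖ ≤ C') {A : Mat (d n)}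
    (hA : ‖A‖ ≤ 1) (i : Fin (d n)) :
    ∑ c, ‖∑ a, A a i • conjAdjoint S (conjEntry ψ ⟨n, c, a⟩)‖ ^ 2 ≤ d n * C' ^ 2 := by
  have hC : 0 ≤ C' := (norm_nonneg _).trans hψ
  have h1 : ∀ c, ∑ a, A a i • conjAdjoint S (conjEntry ψ ⟨n, c, a⟩) =
      conjAdjoint S (∑ a, conj (A a i) • conjEntry ψ ⟨n, c, a⟩) := by
    intro c
    rw [map_sum]
    refine Finset.sum_congr rfl fun b _ => ?_
    rw [LinearMap.map_smulₛₗ, Complex.conj_conj]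
  have hK : (√(d n : ℝ) * C') ^ 2 = d n * C' ^ 2 := by
    rw [mul_pow, Real.sq_sqrt (Nat.cast_nonneg _)]
  simp only [h1]
  rw [← hK]
  refine sum_norm_sq_conjAdjoint_le hS _ (by positivity) ?_
  filter_upwards [ae_all_iff.2 fun c => coeFn_finset_sum_smul Finset.univ (fun a => conj (A a i))
    (fun a => conjEntry ψ ⟨n, c, a⟩), coeFn_conjEntry ψ, ae_norm_le_norm_of_memLp_top (ψ n)]
    with t h2 h3 h4
  have h5 : ∀ c, ‖(∑ a, conj (A a i) • conjEntry ψ ⟨n, c, a⟩ : Lp ℂ ∞ m) t‖ =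
      √(d n : ℝ) * ‖(ψ n t * A) c i‖ := by
    intro c
    have h6 : (∑ a, conj (A a i) • conjEntry ψ ⟨n, c, a⟩ : Lp ℂ ∞ m) t =
        conj (((√(d n : ℝ) : ℝ) : ℂ) * (ψ n t * A) c i) := by
      rw [h2, Matrix.mul_apply, Finset.mul_sum, map_sum]
      refine Finset.sum_congr rfl fun b _ => ?_
      rw [h3, normalizedEntry]
      simp only [map_mul]
      ring
    rw [h6, Complex.norm_conj, norm_mul, Complex.norm_real,
      Real.norm_of_nonneg (Real.sqrt_nonneg _)]
  simp only [h5, mul_pow]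
  rw [← Finset.mul_sum]
  refine mul_le_mul_of_nonneg_left ((sum_norm_sq_col_le _ i).trans ?_) (by positivity)
  refine pow_le_pow_left₀ (norm_nonneg _) ((Matrix.l2_opNorm_mul _ _).trans ?_) 2
  calc ‖ψ n t‖ * ‖A‖ ≤ C' * 1 := mul_le_mul (h4.trans hψ) hA (norm_nonneg _) hC
    _ = C' := mul_one _

-- The weight d_n splits as √d_n · √d_n between the two factors, and the whole sum is conjugated,
-- which leaves its modulus unchanged.
omit [IsProbabilityMeasure m] in
theorem ae_norm_sum_conjEntry_le (ψ : (n : Fin N) → Lp (Mat (d n)) ∞ m)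
    (x : (n : Fin N) → Mat (d n)) {M : ℝ}
    (hM : ∀ᵐ t ∂m.prod m,
      ‖∑ n, (d n : ℂ) * (x n * dotTensor (ψ n) (ψ n) t).trace‖ ≤ M) :
    ∀ᵐ t ∂m.prod m, ‖∑ j : TripleIndex d, conj (x j.1 j.2.1 j.2.2.1) *
      (conjEntry ψ j.fst t.1 * conjEntry ψ j.snd t.2)‖ ≤ M := by
  filter_upwards [hM, Measure.quasiMeasurePreserving_fst.ae (coeFn_conjEntry ψ),
    Measure.quasiMeasurePreserving_snd.ae (coeFn_conjEntry ψ)] with t h1 h2 h3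
  have h4 : ∑ j : TripleIndex d, conj (x j.1 j.2.1 j.2.2.1) *
      (conjEntry ψ j.fst t.1 * conjEntry ψ j.snd t.2) =
      conj (∑ n, (d n : ℂ) * (x n * dotTensor (ψ n) (ψ n) t).trace) := by
    rw [sum_tripleIndex, map_sum]
    refine Finset.sum_congr rfl fun n _ => ?_
    have h5 : ((√(d n : ℝ) : ℝ) : ℂ) * ((√(d n : ℝ) : ℝ) : ℂ) = d n := by
      rw [← Complex.ofReal_mul, Real.mul_self_sqrt (Nat.cast_nonneg _)]
      norm_cast
    rw [← h5]
    simp only [Matrix.trace, Matrix.diag_apply, Matrix.mul_apply, dotTensor, Finset.mul_sum, map_sum]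
    refine Finset.sum_congr rfl fun a _ => Finset.sum_congr rfl fun b _ =>
      Finset.sum_congr rfl fun c _ => ?_
    rw [h2, h3]
    change conj (x n a b) * (conj (((√(d n : ℝ) : ℝ) : ℂ) * ψ n t.1 b c) *
      conj (((√(d n : ℝ) : ℝ) : ℂ) * ψ n t.2 c a)) = _
    simp only [map_mul, Complex.conj_ofReal]
    ring
  rwa [h4, Complex.norm_conj]

end Estimates

end Sidon

/-! ### Transfer to Gaussian space and the absorption argument. -/

section Main

variable {T : Type*} [MeasurableSpace T] {m : Measure T} [IsProbabilityMeasure m]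
  {Ω : Type*} [MeasurableSpace Ω] {P : Measure Ω} [IsProbabilityMeasure P]
  {N : ℕ} {d : Fin N → ℕ}

omit [IsProbabilityMeasure m] in
/-- Transfer of a domination by Gaussian matrices to the canonical Gaussian space. -/
theorem exists_contraction_stdGaussian
    {g : (n : Fin N) → Matrix (Fin (d n)) (Fin (d n)) (Lp ℂ 1 P)} (hg : IsGaussianMatrixSystem g)
    {φ : EntryIndex d → Lp ℂ 1 m} (hφ : IsDominatedBy 1 φ (normalizedEntryL1 g)) :
    ∃ S : Lp ℂ 1 (stdGaussian (EuclideanSpace ℂ (EntryIndex d))) →L[ℂ] Lp ℂ 1 m, ‖S‖ ≤ 1 ∧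
      ∀ p, S (inclL2L1 _ (coord p)) = (√2 : ℂ) • φ p := by
  obtain ⟨S, hS, hSφ⟩ := hφ
  have hΓ := measurePreserving_stdGaussian_of_iIndepFun
    (fun p => measurable_coeFn_Lp (normalizedEntryL1 g p)) hg.law hg.indep
  let U := Lp.compMeasurePreservingₗᵢ (p := 1) (E := ℂ) ℂ _ hΓ
  refine ⟨S.comp U.toContinuousLinearMap, ?_, fun p => ?_⟩
  · refine (S.opNorm_comp_le _).trans ?_
    calc ‖S‖ * ‖U.toContinuousLinearMap‖ ≤ 1 * 1 :=
          mul_le_mul hS U.norm_toContinuousLinearMap_le (norm_nonneg _) zero_le_one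
      _ = 1 := one_mul 1
  · have h1 : U (inclL2L1 _ (coord p)) = (√2 : ℂ) • normalizedEntryL1 g p := by
      refine Lp.ext ?_
      filter_upwards [Lp.coeFn_compMeasurePreserving (inclL2L1 _ (coord p)) hΓ,
        Lp.coeFn_smul (√2 : ℂ) (normalizedEntryL1 g p),
        hΓ.quasiMeasurePreserving.ae (coeFn_inclL2L1 (coord p)),
        hΓ.quasiMeasurePreserving.ae (memLp_coord p).coeFn_toLp] with ω h2 h3 h4 h5
      refine h2.trans ?_
      rw [h3, Function.comp_apply, h4, coord, h5, Pi.smul_apply, PiLp.smul_apply,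
        Complex.real_smul, smul_eq_mul]
    rw [ContinuousLinearMap.comp_apply]
    change S (U _) = _
    rw [h1, map_smul, hSφ]

-- The conjugation in `conjEntry` makes the duality pairing with φ_p equal to the biorthogonality
-- integral; the conjugate linear adjoint then pairs with conj(x_p).
omit [IsProbabilityMeasure m] in
theorem conjCoordPairing_conjAdjoint
    {S : Lp ℂ 1 (stdGaussian (EuclideanSpace ℂ (EntryIndex d))) →L[ℂ] Lp ℂ 1 m}
    {φ : EntryIndex d → Lp ℂ 1 m} (hS : ∀ p, S (inclL2L1 _ (coord p)) = (√2 : ℂ) • φ p)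
    {ψ : (n : Fin N) → Lp (Mat (d n)) ∞ m}
    (hφ : IsBiorthogonal m (fun p t => φ p t) (normalizedEntry fun n t => ψ n t))
    (p q : EntryIndex d) :
    conjCoordPairing p (conjAdjoint S (conjEntry ψ q)) = if p = q then (√2 : ℂ) else 0 := by
  have h1 : conjCoordPairing p (conjAdjoint S (conjEntry ψ q)) =
      conj (inner ℂ (conjAdjoint S (conjEntry ψ q)) (coord p)) := by
    rw [conjCoordPairing, mulPairing_apply, L2.inner_def, ← integral_conj]
    refine integral_congr_ae ?_
    filter_upwards [(memLp_conj_coord p).coeFn_toLp, (memLp_coord p).coeFn_toLp] with x h2 h3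
    rw [h2, coord, h3, RCLike.inner_apply, map_mul, Complex.conj_conj]
  have h2 : ∫ t, conjEntry ψ q t * ((√2 : ℂ) • φ p : Lp ℂ 1 m) t ∂m =
      (√2 : ℂ) * ∫ t, φ p t * conj (normalizedEntry (fun n t => ψ n t) q t) ∂m := by
    rw [← integral_const_mul]
    refine integral_congr_ae ?_
    filter_upwards [coeFn_conjEntry ψ, Lp.coeFn_smul (√2 : ℂ) (φ p)] with t h3 h4
    rw [h3, h4, Pi.smul_apply, smul_eq_mul]
    ring
  rw [h1, inner_conjAdjoint, hS, topOnePairing_apply, h2, hφ p q]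
  split_ifs <;> simp

/-- AB is a unitary polar factor of x, and the left side is tr(x (AB)*). The weight is the entrywise
conjugate of AB, which is the w fed to `conjChaosForm`. -/
theorem sum_mul_conj_eq_sum_singularValues {k : ℕ} {x A B : Mat k} {l : Fin k → ℝ}
    (hA : Aᴴ * A = 1) (hB : B * Bᴴ = 1)
    (hx : x = A * Matrix.diagonal (fun i => (l i : ℂ)) * B) :
    ∑ a, ∑ b, x a b * ((A * B)ᴴ)ᵀ a b = ((∑ i, l i : ℝ) : ℂ) := by
  have h1 : ∑ a, ∑ b, x a b * ((A * B)ᴴ)ᵀ a b = (x * (A * B)ᴴ).trace := rfl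
  rw [h1, hx, Matrix.conjTranspose_mul]
  calc (A * Matrix.diagonal (fun i => (l i : ℂ)) * B * (Bᴴ * Aᴴ)).trace
      = (A * Matrix.diagonal (fun i => (l i : ℂ)) * (B * Bᴴ) * Aᴴ).trace := by
        simp only [Matrix.mul_assoc]
    _ = ((Aᴴ * A) * Matrix.diagonal (fun i => (l i : ℂ))).trace := by
        rw [hB, Matrix.mul_one, Matrix.trace_mul_comm, Matrix.mul_assoc]
    _ = _ := by
        rw [hA, Matrix.one_mul, Matrix.trace_diagonal]
        push_cast
        rfl

theorem sum_traceAbs_le {g : (n : Fin N) → Matrix (Fin (d n)) (Fin (d n)) (Lp ℂ 1 P)}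
    (hg : IsGaussianMatrixSystem g) {ψ : (n : Fin N) → Lp (Mat (d n)) ∞ m} {C' : ℝ}
    (hψ : ∀ n, ‖ψ n‖ ≤ C') {φ : EntryIndex d → Lp ℂ 1 m}
    (hφ : IsBiorthogonal m (fun p t => φ p t) (normalizedEntry fun n t => ψ n t))
    (hdom : IsDominatedBy 1 φ (normalizedEntryL1 g)) {ρ : ℝ} (h0 : 0 < ρ) (h1 : ρ < 1)
    (hρ : ρ ^ 2 * C' ^ 2 ≤ 1 / 2) (x : (n : Fin N) → Mat (d n)) {M : ℝ}
    (hM : ∀ᵐ t ∂m.prod m, ‖∑ n, (d n : ℂ) * (x n * dotTensor (ψ n) (ψ n) t).trace‖ ≤ M) :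
    ∑ n, (d n : ℝ) * traceAbs (x n) ≤ 2 / ρ * M := by
  obtain ⟨S, hS, hSφ⟩ := exists_contraction_stdGaussian hg hdom
  set h := fun q => conjAdjoint S (conjEntry ψ q)
  choose A B l hA hB hl hx hsum using fun n => exists_singularValueDecomposition (x n)
  have hw : ∀ n, ((A n * B n)ᴴ)ᵀ * (((A n * B n)ᴴ)ᵀ)ᴴ = 1 := by
    intro n
    have h2 : (A n * B n) * (A n * B n)ᴴ = 1 := by
      rw [Matrix.conjTranspose_mul, Matrix.mul_assoc, ← Matrix.mul_assoc (B n), hB, Matrix.one_mul]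
      exact mul_eq_one_comm.1 (hA n)
    have h3 := congrArg Matrix.transpose h2
    rw [Matrix.transpose_mul, Matrix.transpose_one] at h3
    rw [← h3]
    congr 1
    ext i j
    exact star_star _
  obtain ⟨R, hR, hRM⟩ := exists_remainder_conjChaosForm (fun n => ((A n * B n)ᴴ)ᵀ) hw h0 h1
  have htensor := ae_norm_sum_conjAdjoint_mul_le hS
    (fun j : TripleIndex d => conj (x j.1 j.2.1 j.2.2.1)) (fun j => conjEntry ψ j.fst)
    (fun j => conjEntry ψ j.snd) (ae_norm_sum_conjEntry_le ψ x hM)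
  simp only [Complex.conj_conj] at htensor
  have hmain := hRM (TripleIndex d) (fun j => x j.1 j.2.1 j.2.2.1) (fun j => h j.fst)
    (fun j => h j.snd) M htensor
  set s : ℝ := ∑ n, (d n : ℝ) * traceAbs (x n) with hs
  have hs0 : 0 ≤ s := Finset.sum_nonneg fun n _ => by
    rw [← hsum]
    exact mul_nonneg (Nat.cast_nonneg _) (Finset.sum_nonneg fun i _ => hl n i)
  have hQ : ∑ j : TripleIndex d, x j.1 j.2.1 j.2.2.1 *
      conjChaosForm (fun n => ((A n * B n)ᴴ)ᵀ) (h j.fst) (h j.snd) = (s : ℂ) := by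
    simp only [conjChaosForm_of_biorthogonal _ h (conjCoordPairing_conjAdjoint hSφ hφ)]
    rw [sum_tripleIndex, hs, Complex.ofReal_sum]
    refine Finset.sum_congr rfl fun n _ => ?_
    rw [Complex.ofReal_mul, ← hsum, ← sum_mul_conj_eq_sum_singularValues (hA n) (hB n) (hx n)]
    simp only [Finset.mul_sum]
    refine Finset.sum_congr rfl fun a _ => Finset.sum_congr rfl fun b _ => ?_
    -- The summand does not depend on c: the free sum over c creates the weight d_n.
    change ∑ _c : Fin (d n), x n a b * ((A n * B n)ᴴ)ᵀ a b =
      ((d n : ℝ) : ℂ) * (x n a b * ((A n * B n)ᴴ)ᵀ a b)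
    rw [Finset.sum_const, Finset.card_univ, Fintype.card_fin, nsmul_eq_mul, Complex.ofReal_natCast]
  have hRs : ‖∑ j : TripleIndex d, x j.1 j.2.1 j.2.2.1 * R (h j.fst) (h j.snd)‖ ≤ s / 2 := by
    rw [sum_tripleIndex, hs, Finset.sum_div]
    refine (norm_sum_le _ _).trans (Finset.sum_le_sum fun n _ => ?_)
    have hBn : ‖B n‖ ≤ 1 := by
      rw [← Matrix.l2_opNorm_conjTranspose]
      exact norm_le_one_of_conjTranspose_mul_self (by rw [Matrix.conjTranspose_conjTranspose, hB])
    refine (norm_sum_trilinear_le R (by positivity) hR (hl n) (hx n) (fun b c => h ⟨n, b, c⟩)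
      (sum_norm_sq_row_conjAdjoint_le hS ψ (hψ n) hBn)
      (sum_norm_sq_col_conjAdjoint_le hS ψ (hψ n)
        (norm_le_one_of_conjTranspose_mul_self (hA n)))).trans ?_
    rw [hsum]
    have h2 : 0 ≤ (d n : ℝ) * traceAbs (x n) := by
      rw [← hsum]
      exact mul_nonneg (Nat.cast_nonneg _) (Finset.sum_nonneg fun i _ => hl n i)
    calc ρ ^ 2 * (d n * C' ^ 2) * traceAbs (x n) = ρ ^ 2 * C' ^ 2 * (d n * traceAbs (x n)) := by ring
      _ ≤ 1 / 2 * (d n * traceAbs (x n)) := mul_le_mul_of_nonneg_right hρ h2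
      _ = _ := by ring
  rw [hQ] at hmain
  have h3 : ‖(s : ℂ)‖ = s := by rw [Complex.norm_real, Real.norm_of_nonneg hs0]
  have h4 := norm_sub_norm_le (s : ℂ)
    (∑ j : TripleIndex d, x j.1 j.2.1 j.2.2.1 * R (h j.fst) (h j.snd))
  rw [h3] at h4
  -- Absorption: s ≤ M/ρ + s/2, where s is finite.
  have h5 : s / 2 ≤ M / ρ := by linarith
  calc s = 2 * (s / 2) := by ring
    _ ≤ 2 * (M / ρ) := by linarith
    _ = 2 / ρ * M := by ring

end Main

end MatricialSidon

theorem mainTheorem9 (C' : ℝ) :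
    ∃ α : ℝ, 0 < α ∧
      ∀ (T : Type u) [MeasurableSpace T] (m : Measure T) [IsProbabilityMeasure m]
        (Ω : Type v) [MeasurableSpace Ω] (P : Measure Ω) [IsProbabilityMeasure P]
        (N : ℕ) (d : Fin N → ℕ)
        (g : (n : Fin N) → Matrix (Fin (d n)) (Fin (d n)) (Lp ℂ 1 P))
        (ψ : (n : Fin N) → Lp (MatricialSidon.Mat (d n)) ∞ m),
        MatricialSidon.IsGaussianMatrixSystem g →
        (∀ n, ‖ψ n‖ ≤ C') →
        (∃ φ : MatricialSidon.EntryIndex d → Lp ℂ 1 m,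
          MatricialSidon.IsBiorthogonal m (fun p t => φ p t)
            (MatricialSidon.normalizedEntry fun n t => ψ n t) ∧
          MatricialSidon.IsDominatedBy 1 φ (MatricialSidon.normalizedEntryL1 g)) →
        MatricialSidon.IsDotTensorSqSidon m (fun n t => ψ n t) α := by
  -- This gives 0 < ρ < 1 and ρ|C'| ≤ 1/2 for every real C', so that the remainder takes at most
  -- half of the sum.
  set ρ : ℝ := (2 * (1 + |C'|))⁻¹ with hρd
  have hC : 0 ≤ |C'| := abs_nonneg C'
  have h0 : 0 < ρ := by positivity
  have h1 : ρ < 1 := inv_lt_one_of_one_lt₀ (by linarith)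
  have hρ : ρ ^ 2 * C' ^ 2 ≤ 1 / 2 := by
    have h2 : ρ * |C'| ≤ 1 / 2 := by
      rw [hρd, inv_mul_le_iff₀ (by positivity)]
      linarith
    rw [← sq_abs C', ← mul_pow]
    nlinarith [mul_nonneg h0.le hC]
  refine ⟨2 / ρ, by positivity, ?_⟩
  rintro T _ m _ Ω _ P _ N d g ψ hg hψ ⟨φ, hφ, hdom⟩ s x
  have hα : (0 : ℝ) < 2 / ρ := by positivity
  -- An infinite norm makes the right side ∞, since α > 0; otherwise the norm can serve as the real
  -- bound M.
  by_cases htop : eLpNorm (fun t => ∑ k ∈ s, (d k : ℂ) *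
      (x k * MatricialSidon.dotTensor (ψ k) (ψ k) t).trace) ∞ (m.prod m) = ∞
  · rw [htop, ENNReal.mul_top (by simpa using hα)]
    exact le_top
  set F := fun t => ∑ k ∈ s, (d k : ℂ) *
      (x k * MatricialSidon.dotTensor (ψ k) (ψ k) t).trace with hF
  -- Extension by zero reduces the finite set s to the full index set.
  let y : (n : Fin N) → MatricialSidon.Mat (d n) := fun n => if n ∈ s then x n else 0
  have hy : ∀ t, ∑ n, (d n : ℂ) * (y n * MatricialSidon.dotTensor (ψ n) (ψ n) t).trace = F t := by
    intro t
    rw [hF, ← Finset.sum_subset (Finset.subset_univ s)]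
    · exact Finset.sum_congr rfl fun n hn => by simp only [y, if_pos hn]
    · intro n _ hn
      simp [y, hn]
  have hy' : ∑ n, (d n : ℝ) * MatricialSidon.traceAbs (y n) =
      ∑ k ∈ s, (d k : ℝ) * MatricialSidon.traceAbs (x k) := by
    rw [← Finset.sum_subset (Finset.subset_univ s)]
    · exact Finset.sum_congr rfl fun n hn => by simp only [y, if_pos hn]
    · intro n _ hn
      simp [y, hn, MatricialSidon.traceAbs]
  have hM : ∀ᵐ t ∂m.prod m, ‖∑ n, (d n : ℂ) *
      (y n * MatricialSidon.dotTensor (ψ n) (ψ n) t).trace‖ ≤ (eLpNorm F ∞ (m.prod m)).toReal := by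
    filter_upwards [ae_le_eLpNormEssSup (f := F) (μ := m.prod m)] with t ht
    rw [hy, ← toReal_enorm]
    rw [← eLpNorm_exponent_top] at ht
    exact ENNReal.toReal_mono htop ht
  have key := MatricialSidon.sum_traceAbs_le hg hψ hφ hdom h0 h1 hρ y hM
  rw [hy'] at key
  refine (ENNReal.ofReal_le_ofReal key).trans ?_
  rw [ENNReal.ofReal_mul hα.le, ENNReal.ofReal_toReal htop]
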